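/- Let $\mathbb S^1=\mathbb R/\mathbb Z$ with geodesic distance $d(x,y)=\min_{k\in\mathbb Z}|x-y-k|$, and for $k\ge 0$ let $H^k=H^k(\mathbb S^1;\mathbb R^2)$ be the $L^2$-based Sobolev space with norm $\|u\|_{H^k}^2=\sum_{j=0}^k\|\partial_x^j u\|_{L^2}^2$; elements of $H^1$ are identified with their continuous representatives, and elements of $H^2$ with their $C^1$ representatives. For $\gamma\in H^2$ put $$|\gamma|_*=\inf_{x\ne y}\frac{|\gamma(x)-\gamma(y)|}{d(x,y)},\qquad V=\{\gamma\in H^2 : |\gamma|_*>0\}.$$ For $\gamma\in V$ define $$\tau(\gamma)=\frac{\gamma'}{|\gamma'|},\qquad \nu(\gamma)=\begin{pmatrix}0&1\\-1&0\end{pmatrix}\tau(\gamma),\qquad \kappa(\gamma)=-\frac{\nu(\gamma)\cdot\gamma''}{|\gamma'|},$$ and, with $\Delta\gamma(x,y)=\gamma(y)-\gamma(x)$, $$K(\gamma)(x,y)=\frac{(\nu(\gamma)(x)\cdot\Delta\gamma(x,y))\,(\nu(\gamma)(y)\cdot\Delta\gamma(x,y))}{|\Delta\gamma(x,y)|^3}\quad(x\ne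 y),$$ $$F(\gamma)(x)=-\frac1{2\pi}\int_{\mathbb S^1}K(\gamma)(x,y)\,\kappa(\gamma)(y)\,dy,\qquad f(\gamma)(x)=F(\gamma)(x)\,\nu(\gamma)(x).$$ Then $V$ is open in $H^2$; for every $\gamma\in V$ and every $x\in\mathbb S^1$ the integral defining $F(\gamma)(x)$ converges absolutely; $f(\gamma)\in H^1$ for every $\gamma\in V$, with continuous representative $x\mapsto F(\gamma)(x)\nu(\gamma)(x)$; and the map $f\colon V\to H^1$ is of class $C^\infty$ (in the sense of Fréchet derivatives of all orders). -/

import Mathlib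

open MeasureTheory
open scoped ContDiff

noncomputable section

namespace Langmuir

/-- The plane `ℝ²` with its Euclidean norm. -/
abbrev Plane : Type := EuclideanSpace ℝ (Fin 2)

/-- The circle `𝕊¹ = ℝ/ℤ`. Its distance is the geodesic one, `min_k |x - y - k|`, and its
`volume` is the arc length, of total mass `1`. -/
abbrev Circ : Type := UnitAddCircle

/-- `L²(𝕊¹; ℝ²)`. -/
abbrev L2 : Type := Lp Plane 2 (volume : Measure Circ)

/-- Smooth test functions on the circle: the lift to `ℝ` is `C^∞`. -/
def IsTest (φ : Circ → ℝ) : Prop := ContDiff ℝ ∞ (fun t : ℝ => φ (t : Circ))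

/-- The derivative of a function on the circle. -/
def circDeriv (φ : Circ → ℝ) (x : Circ) : ℝ := deriv (fun t : ℝ => φ (x + (t : Circ))) 0

/-- `v` is the weak (distributional) derivative of `u` on the circle. -/
def IsWeakDeriv (u v : Circ → Plane) : Prop :=
  ∀ φ : Circ → ℝ, IsTest φ → (∫ x, circDeriv φ x • u x) = -(∫ x, φ x • v x)

theorem circDeriv_coe (φ : Circ → ℝ) (s : ℝ) :
    circDeriv φ (s : Circ) = deriv (fun t : ℝ => φ (t : Circ)) s := by
  have h : (fun t : ℝ => φ ((s : Circ) + (t : Circ))) =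
      fun t : ℝ => (fun r : ℝ => φ (r : Circ)) (s + t) := by
    funext t
    simp
  rw [circDeriv, h, deriv_comp_const_add (fun r : ℝ => φ (r : Circ)) s 0, add_zero]

theorem IsTest.continuous {φ : Circ → ℝ} (h : IsTest φ) : Continuous φ :=
  continuous_coinduced_dom.mpr (ContDiff.continuous h)

theorem IsTest.continuous_circDeriv {φ : Circ → ℝ} (h : IsTest φ) :
    Continuous (circDeriv φ) := by
  refine continuous_coinduced_dom.mpr ?_
  have h2 : (circDeriv φ ∘ fun t : ℝ => (t : Circ)) = deriv (fun t : ℝ => φ (t : Circ)) :=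
    funext fun s => circDeriv_coe φ s
  exact h2 ▸ ContDiff.continuous_deriv h (by simp)

theorem integrable_smul_L2 {ψ : Circ → ℝ} (hψ : Continuous ψ) (u : L2) :
    Integrable (fun x => ψ x • u x) volume := by
  have hu : Integrable (u : Circ → Plane) volume := (Lp.memLp u).integrable one_le_two
  obtain ⟨C, hC⟩ := (isCompact_range hψ).isBounded.exists_norm_le
  refine (hu.norm.const_mul C).mono' (hψ.aestronglyMeasurable.smul hu.aestronglyMeasurable) ?_
  refine Filter.Eventually.of_forall fun x => ?_
  rw [norm_smul]
  exact mul_le_mul_of_nonneg_right (hC (ψ x) (Set.mem_range_self x)) (norm_nonneg _)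

/-- The Sobolev space `H^k(𝕊¹; ℝ²)`. An element is an `L²` function `u 0` together with its weak
derivatives `u 1, …, u k` in `L²` (which are determined by `u 0`); the norm is
`(∑_{j ≤ k} ‖u j‖²_{L²})^{1/2}`. -/
def Sobolev (k : ℕ) : Submodule ℝ (PiLp 2 fun _ : Fin (k + 1) => L2) where
  carrier := {u | ∀ j : Fin k, IsWeakDeriv (u j.castSucc) (u j.succ)}
  zero_mem' := by
    intro j φ _
    have h0 : ((0 : L2) : Circ → Plane) =ᵐ[volume] 0 := Lp.coeFn_zero _ _ _
    have h1 : ∀ ψ : Circ → ℝ, (∫ x, ψ x • ((0 : L2) : Circ → Plane) x) = 0 := by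
      intro ψ
      refine integral_eq_zero_of_ae ?_
      filter_upwards [h0] with x hx
      rw [hx, Pi.zero_apply, smul_zero]

    have h2 := h1 (circDeriv φ)
    have h3 := h1 φ
    simp only [PiLp.zero_apply]
    rw [h2, h3, neg_zero]
  add_mem' := by
    intro u v hu hv j φ hφ
    have key : ∀ (ψ : Circ → ℝ), Continuous ψ → ∀ i : Fin (k + 1),
        (∫ x, ψ x • ((u + v) i : L2) x) = (∫ x, ψ x • u i x) + (∫ x, ψ x • v i x) := by
      intro ψ hψ i
      rw [← integral_add (integrable_smul_L2 hψ _) (integrable_smul_L2 hψ _)]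
      refine integral_congr_ae ?_
      filter_upwards [Lp.coeFn_add (u i) (v i)] with x hx
      rw [PiLp.add_apply, hx, Pi.add_apply, smul_add]
    rw [key _ hφ.continuous_circDeriv, key _ hφ.continuous, hu j φ hφ, hv j φ hφ, neg_add]
  smul_mem' := by
    intro c u hu j φ hφ
    have key : ∀ (ψ : Circ → ℝ) (i : Fin (k + 1)),
        (∫ x, ψ x • ((c • u) i : L2) x) = c • (∫ x, ψ x • u i x) := by
      intro ψ i
      rw [← integral_smul]
      refine integral_congr_ae ?_
      filter_upwards [Lp.coeFn_smul c (u i)] with x hx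
      rw [PiLp.smul_apply, hx, Pi.smul_apply, smul_comm]
    rw [key, key, hu j φ hφ, smul_neg]

open Classical in
/-- The continuous representative of an `L²` class. It is unique, and it exists for all the classes
used below by the Sobolev embedding `H¹ ⊂ C⁰`. -/
def contRep (u : L2) : Circ → Plane :=
  if h : ∃ g : Circ → Plane, Continuous g ∧ g =ᵐ[volume] u then h.choose else 0

/-- The value `γ(x)`. -/
def val {k : ℕ} (γ : Sobolev k) : Circ → Plane := contRep (γ.1 0)

/-- The first derivative `γ'(x)` of `γ ∈ H²`, as a continuous function. -/
def d1 (γ : Sobolev 2) : Circ → Plane := contRep (γ.1 1)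

/-- The second derivative `γ''(x)` of `γ ∈ H²`, defined almost everywhere. -/
def d2 (γ : Sobolev 2) : Circ → Plane := γ.1 2

/-- The chord-arc constant `|γ|_*`. -/
def chordArc (γ : Sobolev 2) : ℝ :=
  ⨅ p : {p : Circ × Circ // p.1 ≠ p.2}, ‖val γ p.1.1 - val γ p.1.2‖ / dist p.1.1 p.1.2

/-- The admissible set `V ⊂ H²`. -/
def V : Set (Sobolev 2) := {γ | 0 < chordArc γ}

/-- The unit tangent `τ(γ)`. -/
def tangent (γ : Sobolev 2) (x : Circ) : Plane := ‖d1 γ x‖⁻¹ • d1 γ x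

/-- The unit normal `ν(γ)`, the rotation of `τ(γ)` by the matrix with rows `(0, 1)`, `(-1, 0)`. -/
def normal (γ : Sobolev 2) (x : Circ) : Plane := !₂[tangent γ x 1, -tangent γ x 0]

/-- The curvature density `κ(γ)`. -/
def curvature (γ : Sobolev 2) (x : Circ) : ℝ := -inner ℝ (normal γ x) (d2 γ x) / ‖d1 γ x‖

/-- The chord `Δγ(x, y) = γ(y) - γ(x)`. -/
def chord (γ : Sobolev 2) (x y : Circ) : Plane := val γ y - val γ x

/-- The kernel `K(γ)(x, y)` for `x ≠ y`. -/
def kernel (γ : Sobolev 2) (x y : Circ) : ℝ :=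
  inner ℝ (normal γ x) (chord γ x y) * inner ℝ (normal γ y) (chord γ x y) / ‖chord γ x y‖ ^ 3

/-- The scalar nonlocal term `F(γ)`. -/
def nonlocalF (γ : Sobolev 2) (x : Circ) : ℝ :=
  -(1 / (2 * Real.pi)) * ∫ y, kernel γ x y * curvature γ y

/-- The forcing `f(γ) = F(γ) ν(γ)`, as a function on the circle. -/
def forcing (γ : Sobolev 2) (x : Circ) : Plane := nonlocalF γ x • normal γ x

end Langmuir

end

/-! The rotated tangent annihilates the first-order Taylor term of a chord. So the kernel of `F(γ)`
is a product of bounded quantities and of a second-order quotient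
`q(x, y) = (γ(y) - γ(x) - (y - x) γ'(x)) / |y - x|²`. The bounded quantities, among them the
difference quotient `(γ(y) - γ(x)) / |y - x|` and, by the chord-arc condition, its inverse norm,
depend smoothly on `γ` as bounded continuous functions off the diagonal. The quotient `q` is linear
in `γ` and dominated by averages of `|γ''|`, so by Hardy's inequality it is bounded by `‖γ‖_{H²}` in
`L²` of either variable, uniformly in the other one.

Differentiating in `x` produces products of at most two quotients, either `q` or
`(γ'(y) - γ'(x)) / |y - x|`, with `γ''(y)` and possibly `γ''(x)`: again continuous multilinear maps
into `L²`, so `f` and its formal derivative are smooth maps from `V` to `L²`. The formal derivative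
is the weak one: for fixed `y` integrate by parts in `x` away from `x = y`; no boundary term
survives, because the kernel is at most `C |∫_x^y |γ''|²|`, which vanishes at the diagonal. Finally
`H¹` is complete, hence closed among the pairs in `L² × L²`. -/

noncomputable section

namespace Langmuir

open Set Filter Topology
open scoped Interval ENNReal BoundedContinuousFunction

/-! ### Absolutely continuous functions -/

/-- `f` is absolutely continuous between `a` and `b` and `g` is its derivative almost everywhere.
This is the regularity of the derivative of an `H²` function. -/
structure HasACDeriv (f g : ℝ → ℝ) (a b : ℝ) : Prop where
  ac : AbsolutelyContinuousOnInterval f a b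
  hasDerivAt : ∀ᵐ x, x ∈ uIcc a b → HasDerivAt f (g x) x

theorem absolutelyContinuousOnInterval_comp {X Y : Type*} [PseudoMetricSpace X]
    [PseudoMetricSpace Y] {φ : X → Y} {f : ℝ → X} {a b : ℝ} {C : NNReal}
    (hφ : LipschitzOnWith C φ (f '' uIcc a b)) (hf : AbsolutelyContinuousOnInterval f a b) :
    AbsolutelyContinuousOnInterval (φ ∘ f) a b := by
  rw [AbsolutelyContinuousOnInterval] at *
  have hlim : Tendsto (fun E : ℕ × (ℕ → ℝ × ℝ) => C * ∑ i ∈ Finset.range E.1,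
      dist (f (E.2 i).1) (f (E.2 i).2)) (AbsolutelyContinuousOnInterval.totalLengthFilter ⊓
        𝓟 (AbsolutelyContinuousOnInterval.disjWithin a b)) (𝓝 0) := by
    simpa only [mul_zero] using hf.const_mul (C : ℝ)
  refine squeeze_zero' (Eventually.of_forall fun E => Finset.sum_nonneg fun i _ => dist_nonneg)
    ?_ hlim
  filter_upwards [mem_inf_of_right (mem_principal_self _)] with E hE
  rw [Finset.mul_sum]
  exact Finset.sum_le_sum fun i hi => hφ.dist_le_mul _ (mem_image_of_mem f (hE.1 i hi).1) _
    (mem_image_of_mem f (hE.1 i hi).2)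

namespace HasACDeriv

variable {f g f₁ g₁ : ℝ → ℝ} {a b : ℝ}

theorem integral_eq (h : HasACDeriv f g a b) : ∫ x in a..b, g x = f b - f a := by
  rw [← h.ac.integral_deriv_eq_sub]
  refine intervalIntegral.integral_congr_ae ?_
  filter_upwards [h.hasDerivAt] with x hx hx'
  exact (hx (uIoc_subset_uIcc hx')).deriv.symm

theorem continuousOn (h : HasACDeriv f g a b) : ContinuousOn f (uIcc a b) := h.ac.continuousOn

theorem add (h : HasACDeriv f g a b) (h₁ : HasACDeriv f₁ g₁ a b) :
    HasACDeriv (fun x => f x + f₁ x) (fun x => g x + g₁ x) a b :=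
  ⟨h.ac.add h₁.ac, by
    filter_upwards [h.hasDerivAt, h₁.hasDerivAt] with x hx hx₁ hm using (hx hm).add (hx₁ hm)⟩

theorem neg (h : HasACDeriv f g a b) : HasACDeriv (fun x => -f x) (fun x => -g x) a b :=
  ⟨h.ac.neg, by filter_upwards [h.hasDerivAt] with x hx hm using (hx hm).neg⟩

theorem sub (h : HasACDeriv f g a b) (h₁ : HasACDeriv f₁ g₁ a b) :
    HasACDeriv (fun x => f x - f₁ x) (fun x => g x - g₁ x) a b := by
  simpa only [sub_eq_add_neg] using h.add h₁.neg

theorem mul (h : HasACDeriv f g a b) (h₁ : HasACDeriv f₁ g₁ a b) :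
    HasACDeriv (fun x => f x * f₁ x) (fun x => g x * f₁ x + f x * g₁ x) a b :=
  ⟨h.ac.mul h₁.ac, by
    filter_upwards [h.hasDerivAt, h₁.hasDerivAt] with x hx hx₁ hm using (hx hm).mul (hx₁ hm)⟩

theorem const (c : ℝ) : HasACDeriv (fun _ => c) (fun _ => 0) a b :=
  ⟨(LipschitzWith.const c).lipschitzOnWith.absolutelyContinuousOnInterval,
    Eventually.of_forall fun x _ => hasDerivAt_const x c⟩

theorem congr_deriv (h : HasACDeriv f g a b) (hg : ∀ x ∈ uIcc a b, g x = g₁ x) :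
    HasACDeriv f g₁ a b :=
  ⟨h.ac, by filter_upwards [h.hasDerivAt] with x hx hm using hg x hm ▸ hx hm⟩

theorem of_integral (hg : IntervalIntegrable g volume a b)
    (hf : ∀ x, f x = f a + ∫ t in a..x, g t) : HasACDeriv f g a b := by
  have hfe : f = fun x => f a + ∫ t in a..x, g t := funext hf
  have hac := (const (f a)).ac.add
    (hg.absolutelyContinuousOnInterval_intervalIntegral left_mem_uIcc)
  refine ⟨hfe ▸ hac, ?_⟩
  filter_upwards [hg.ae_hasDerivAt_integral] with x hx hm
  rw [hfe]
  exact (hx hm a left_mem_uIcc).const_add (f a)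

theorem comp {φ φ' : ℝ → ℝ} (h : HasACDeriv f g a b)
    (hφ : ∀ y ∈ f '' uIcc a b, HasDerivAt φ (φ' y) y) (hφ' : ContinuousOn φ' (f '' uIcc a b)) :
    HasACDeriv (fun x => φ (f x)) (fun x => φ' (f x) * g x) a b := by
  have hcompact : IsCompact (f '' uIcc a b) := isCompact_uIcc.image_of_continuousOn h.continuousOn
  have hconvex : Convex ℝ (f '' uIcc a b) :=
    (isPreconnected_uIcc.image f h.continuousOn).ordConnected.convex
  obtain ⟨C, hC⟩ := hcompact.exists_bound_of_continuousOn hφ'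
  have hlip : LipschitzOnWith C.toNNReal φ (f '' uIcc a b) :=
    hconvex.lipschitzOnWith_of_nnnorm_hasDerivWithin_le
      (fun y hy => (hφ y hy).hasDerivWithinAt) fun y hy =>
        NNReal.coe_le_coe.mp ((hC y hy).trans (Real.le_coe_toNNReal C))
  refine ⟨absolutelyContinuousOnInterval_comp hlip h.ac, ?_⟩
  filter_upwards [h.hasDerivAt] with x hx hm using (hφ _ (mem_image_of_mem f hm)).comp x (hx hm)

theorem rpow_const (h : HasACDeriv f g a b) (hpos : ∀ x ∈ uIcc a b, 0 < f x) (p : ℝ) :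
    HasACDeriv (fun x => f x ^ p) (fun x => p * f x ^ (p - 1) * g x) a b := by
  have hne : ∀ y ∈ f '' uIcc a b, y ≠ 0 := forall_mem_image.mpr fun x hx => (hpos x hx).ne'
  exact h.comp (φ := (· ^ p)) (φ' := fun y => p * y ^ (p - 1))
    (fun y hy => Real.hasDerivAt_rpow_const (Or.inl (hne y hy)))
    (continuousOn_const.mul (continuousOn_id.rpow_const fun y hy => Or.inl (hne y hy)))

end HasACDeriv

/-! ### Sobolev embedding on the circle -/

/-- `v` is the weak derivative of the scalar function `u` on the circle. -/
def IsWeakDerivReal (u v : Circ → ℝ) : Prop :=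
  ∀ φ : Circ → ℝ, IsTest φ → (∫ x, circDeriv φ x * u x) = -(∫ x, φ x * v x)

/-- `w` is a primitive of `v` along every arc of the circle. -/
def IsPrimitive (w v : Circ → ℝ) : Prop :=
  ∀ a b : ℝ, w (b : Circ) - w (a : Circ) = ∫ t in a..b, v (t : Circ)

theorem intervalIntegrable_coe {E : Type*} [NormedAddCommGroup E] {g : Circ → E}
    (hg : Integrable g) (a b : ℝ) :
    IntervalIntegrable (fun s : ℝ => g (s : Circ)) volume a b := by
  have hper : Function.Periodic (fun s : ℝ => g (s : Circ)) 1 := fun s => by simp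
  refine hper.intervalIntegrable₀ one_ne_zero ?_ a b
  rw [intervalIntegrable_iff_integrableOn_Ioc_of_le zero_le_one]
  have hunit := (UnitAddCircle.measurePreserving_mk 0).integrable_comp_of_integrable hg
  rwa [zero_add] at hunit

theorem continuous_mul_integrable {φ v : Circ → ℝ} (hφ : Continuous φ) (hv : Integrable v) :
    Integrable fun x => φ x * v x := by
  obtain ⟨C, hC⟩ := (isCompact_range hφ).isBounded.exists_norm_le
  exact hv.bdd_mul hφ.aestronglyMeasurable (Eventually.of_forall fun x => hC _ ⟨x, rfl⟩)

theorem ae_eq_fourierCoeff_zero {T : ℝ} [Fact (0 < T)] {u : AddCircle T → ℂ}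
    (hu : MemLp u 2 AddCircle.haarAddCircle) (h : ∀ n : ℤ, n ≠ 0 → fourierCoeff u n = 0) :
    u =ᵐ[AddCircle.haarAddCircle] fun _ => fourierCoeff u 0 := by
  have hcoeff : ∀ n, fourierCoeff (hu.toLp u) n = fourierCoeff u n :=
    fun n => congrFun (fourierCoeff_congr_ae hu.coeFn_toLp) n
  have hseries := hasSum_fourier_series_L2 (hu.toLp u)
  have hsingle := hasSum_single (f := fun n =>
    fourierCoeff (hu.toLp u) n • fourierLp (T := T) 2 n) 0
    fun n hn => by rw [hcoeff, h n hn, zero_smul]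
  have heq : hu.toLp u = fourierCoeff u 0 • fourierLp (T := T) 2 0 :=
    hcoeff 0 ▸ hseries.unique hsingle
  filter_upwards [hu.coeFn_toLp, Lp.coeFn_smul (fourierCoeff u 0) (fourierLp (T := T) 2 0),
    coeFn_fourierLp (T := T) 2 0] with x hx hsmul hone
  rw [← hx, heq, hsmul, Pi.smul_apply, hone, fourier_zero, smul_eq_mul, mul_one]

theorem hasDerivAt_circDeriv {φ : Circ → ℝ} (h : IsTest φ) (s : ℝ) :
    HasDerivAt (fun t : ℝ => φ (t : Circ)) (circDeriv φ (s : Circ)) s := by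
  rw [circDeriv_coe]
  exact (ContDiff.differentiable h (by simp)).differentiableAt.hasDerivAt

theorem hasACDeriv_of_isTest {φ : Circ → ℝ} (h : IsTest φ) (a b : ℝ) :
    HasACDeriv (fun s : ℝ => φ (s : Circ)) (fun s : ℝ => circDeriv φ (s : Circ)) a b :=
  ⟨(ContDiff.of_le h (by simp)).contDiffOn.absolutelyContinuousOnInterval,
    Eventually.of_forall fun s _ => hasDerivAt_circDeriv h s⟩

theorem isTest_clm_fourier (L : ℂ →L[ℝ] ℝ) (n : ℤ) : IsTest fun x => L (fourier n x) := by
  unfold IsTest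
  simp_rw [fourier_coe_apply]
  have h : ContDiff ℝ ∞ fun t : ℝ => (t : ℂ) := Complex.ofRealCLM.contDiff
  fun_prop

theorem circDeriv_clm_fourier (L : ℂ →L[ℝ] ℝ) (n : ℤ) (x : Circ) :
    circDeriv (fun x => L (fourier n x)) x = L (2 * Real.pi * Complex.I * n * fourier n x) := by
  induction x using QuotientAddGroup.induction_on with | H s => ?_
  rw [circDeriv_coe]
  refine (L.hasFDerivAt.comp_hasDerivAt s (hasDerivAt_fourier (1 : ℝ) n s)).deriv.trans ?_
  simp

theorem volume_eq_haarAddCircle : (volume : Measure Circ) = AddCircle.haarAddCircle := by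
  rw [AddCircle.volume_eq_smul_haarAddCircle, ENNReal.ofReal_one, one_smul]

theorem integral_fourier_mul_eq_zero {u : Circ → ℝ} (hu : Integrable u)
    (h : ∀ φ : Circ → ℝ, IsTest φ → ∫ x, circDeriv φ x * u x = 0) {n : ℤ} (hn : n ≠ 0) :
    ∫ x, fourier n x * (u x : ℂ) = 0 := by
  have hint : Integrable (fun x : Circ => fourier n x * (u x : ℂ)) := by
    refine hu.ofReal.bdd_mul (c := 1) (map_continuous (fourier n)).aestronglyMeasurable ?_
    exact Eventually.of_forall fun x => by rw [fourier_apply, Circle.norm_coe]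
  have hfunctional : ∀ L : ℂ →L[ℝ] ℝ,
      L (2 * Real.pi * Complex.I * n * ∫ x, fourier n x * (u x : ℂ)) = 0 := by
    intro L
    rw [← integral_const_mul, ← L.integral_comp_comm (hint.const_mul _),
      ← h _ (isTest_clm_fourier L n)]
    refine integral_congr_ae (Eventually.of_forall fun x => ?_)
    have hreal : 2 * Real.pi * Complex.I * n * (fourier n x * (u x : ℂ))
        = u x • (2 * Real.pi * Complex.I * n * fourier n x) := by
      rw [Complex.real_smul]; ring
    simp only [circDeriv_clm_fourier, hreal, map_smul, smul_eq_mul, mul_comm (u x)]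
  refine (mul_eq_zero.mp (Complex.ext (hfunctional Complex.reCLM)
    (hfunctional Complex.imCLM))).resolve_left ?_
  simp [Real.pi_ne_zero, hn]

theorem ae_eq_const_of_forall_test {u : Circ → ℝ} (hu : MemLp u 2)
    (h : ∀ φ : Circ → ℝ, IsTest φ → ∫ x, circDeriv φ x * u x = 0) :
    ∃ c : ℝ, u =ᵐ[volume] fun _ => c := by
  have hcoeff : ∀ n : ℤ, n ≠ 0 → fourierCoeff (fun x => (u x : ℂ)) n = 0 := fun n hn => by
    rw [fourierCoeff, ← volume_eq_haarAddCircle]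
    exact integral_fourier_mul_eq_zero (hu.integrable one_le_two) h (neg_ne_zero.mpr hn)
  have hconst := ae_eq_fourierCoeff_zero (volume_eq_haarAddCircle ▸ hu.ofReal) hcoeff
  rw [← volume_eq_haarAddCircle] at hconst
  exact ⟨_, hconst.mono fun x hx => by simpa only [Complex.ofReal_re] using congrArg Complex.re hx⟩

theorem exists_isPrimitive {v : Circ → ℝ} (hv : Integrable v) (h0 : ∫ x, v x = 0) :
    ∃ w : Circ → ℝ, IsPrimitive w v := by
  have hi := intervalIntegrable_coe hv
  have hper : Function.Periodic (fun s : ℝ => ∫ t in (0 : ℝ)..s, v (t : Circ)) 1 := fun s => by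
    dsimp only
    rw [← intervalIntegral.integral_add_adjacent_intervals (hi 0 s) (hi s (s + 1)),
      UnitAddCircle.intervalIntegral_preimage s v, h0, add_zero]
  exact ⟨hper.lift, fun a b => intervalIntegral.integral_interval_sub_left (hi _ _) (hi _ _)⟩

namespace IsPrimitive

variable {w v : Circ → ℝ}

theorem hasACDeriv (hw : IsPrimitive w v) (hv : Integrable v) (a b : ℝ) :
    HasACDeriv (fun s : ℝ => w (s : Circ)) (fun s : ℝ => v (s : Circ)) a b :=
  .of_integral (intervalIntegrable_coe hv a b) fun x => by rw [← hw a x, add_sub_cancel]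

theorem continuous (hw : IsPrimitive w v) (hv : Integrable v) : Continuous w := by
  refine continuous_coinduced_dom.mpr ?_
  have heq : (w ∘ fun s : ℝ => (s : Circ)) = fun s : ℝ => w ((0 : ℝ) : Circ) +
      ∫ t in (0 : ℝ)..s, v (t : Circ) := funext fun s => by
    rw [← hw, Function.comp_apply, add_sub_cancel]
  exact heq ▸ continuous_const.add
    (intervalIntegral.continuous_primitive (intervalIntegrable_coe hv) 0)

theorem isWeakDerivReal (hw : IsPrimitive w v) (hv : Integrable v) : IsWeakDerivReal w v := by
  intro φ hφ
  have hparts := ((hasACDeriv_of_isTest hφ 0 1).mul (hw.hasACDeriv hv 0 1)).integral_eq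
  have hcircle := UnitAddCircle.intervalIntegral_preimage 0
    fun x => circDeriv φ x * w x + φ x * v x
  have hends : ((1 : ℝ) : Circ) = ((0 : ℝ) : Circ) := AddCircle.coe_period 1
  rw [zero_add, hparts, hends, sub_self, integral_add
    (continuous_mul_integrable hφ.continuous_circDeriv
      ((hw.continuous hv).integrable_of_hasCompactSupport (.of_compactSpace _)))
    (continuous_mul_integrable hφ.continuous hv)] at hcircle
  linarith

end IsPrimitive

theorem IsWeakDerivReal.integral_eq_zero {u v : Circ → ℝ} (h : IsWeakDerivReal u v) :
    ∫ x, v x = 0 := by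
  have hconst : ∀ x, circDeriv (fun _ : Circ => (1 : ℝ)) x = 0 := fun x => by simp [circDeriv]
  simpa [hconst] using h (fun _ => 1) contDiff_const

theorem IsWeakDerivReal.exists_isPrimitive {u v : Circ → ℝ} (hu : MemLp u 2) (hv : Integrable v)
    (h : IsWeakDerivReal u v) : ∃ w : Circ → ℝ, IsPrimitive w v ∧ w =ᵐ[volume] u := by
  obtain ⟨w₀, hw₀⟩ := Langmuir.exists_isPrimitive hv h.integral_eq_zero
  have hw₀L2 : MemLp w₀ 2 :=
    (hw₀.continuous hv).memLp_of_hasCompactSupport (HasCompactSupport.of_compactSpace _)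
  have hflat : ∀ φ : Circ → ℝ, IsTest φ → ∫ x, circDeriv φ x * (u - w₀) x = 0 := fun φ hφ => by
    have hint {f : Circ → ℝ} (hf : MemLp f 2) : Integrable fun x => circDeriv φ x * f x :=
      continuous_mul_integrable hφ.continuous_circDeriv (hf.integrable one_le_two)
    simp only [Pi.sub_apply, mul_sub]
    rw [integral_sub (hint hu) (hint hw₀L2), h φ hφ, hw₀.isWeakDerivReal hv φ hφ, sub_self]
  obtain ⟨c, hc⟩ := ae_eq_const_of_forall_test (hu.sub hw₀L2) hflat
  refine ⟨fun x => w₀ x + c, fun a b => by rw [add_sub_add_right_eq_sub, hw₀ a b], ?_⟩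
  filter_upwards [hc] with x hx
  rw [← hx, Pi.sub_apply, add_sub_cancel]

/-! ### Hardy's inequality -/

theorem sq_lintegral_mul_le {α : Type*} [MeasurableSpace α] (μ : Measure α) {f g : α → ℝ≥0∞}
    (hf : AEMeasurable f μ) (hg : AEMeasurable g μ) :
    (∫⁻ a, f a * g a ∂μ) ^ 2 ≤ (∫⁻ a, f a ^ 2 ∂μ) * ∫⁻ a, g a ^ 2 ∂μ := by
  have h := ENNReal.lintegral_mul_le_Lp_mul_Lq μ Real.HolderConjugate.two_two hf hg
  simp only [Pi.mul_apply] at h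
  refine (pow_le_pow_left' h 2).trans_eq ?_
  rw [mul_pow, ← ENNReal.rpow_natCast, ← ENNReal.rpow_natCast, ← ENNReal.rpow_mul,
    ← ENNReal.rpow_mul]
  simp

theorem ofReal_rpow_sq {s : ℝ} (hs : 0 ≤ s) (p : ℝ) :
    ENNReal.ofReal (s ^ p) ^ 2 = ENNReal.ofReal (s ^ (p * 2)) := by
  rw [← ENNReal.ofReal_pow (Real.rpow_nonneg hs _), ← Real.rpow_natCast, ← Real.rpow_mul hs,
    Nat.cast_ofNat]

theorem lintegral_Ioc_rpow {t p : ℝ} (ht : 0 < t) (hp : -1 < p) :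
    ∫⁻ s in Ioc 0 t, ENNReal.ofReal (s ^ p) = ENNReal.ofReal (t ^ (p + 1) / (p + 1)) := by
  have hi : IntegrableOn (fun s : ℝ => s ^ p) (Ioc 0 t) := by
    rw [← intervalIntegrable_iff_integrableOn_Ioc_of_le ht.le]
    exact intervalIntegral.intervalIntegrable_rpow' hp
  have hnonneg : ∀ᵐ s ∂volume.restrict (Ioc 0 t), 0 ≤ s ^ p :=
    ae_restrict_of_forall_mem measurableSet_Ioc fun s hs => Real.rpow_nonneg hs.1.le _
  rw [← ofReal_integral_eq_lintegral_ofReal hi hnonneg, ← intervalIntegral.integral_of_le ht.le,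
    integral_rpow (Or.inl hp), Real.zero_rpow (by linarith), sub_zero]

theorem lintegral_Ici_rpow {s p : ℝ} (hs : 0 < s) (hp : p < -1) :
    ∫⁻ t in Ici s, ENNReal.ofReal (t ^ p) = ENNReal.ofReal (-s ^ (p + 1) / (p + 1)) := by
  have hnonneg : ∀ᵐ t ∂volume.restrict (Ioi s), 0 ≤ t ^ p :=
    ae_restrict_of_forall_mem measurableSet_Ioi fun t ht => Real.rpow_nonneg (hs.trans ht).le _
  rw [setLIntegral_congr Ioi_ae_eq_Ici.symm, ← ofReal_integral_eq_lintegral_ofReal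
    (integrableOn_Ioi_rpow_of_lt hp hs) hnonneg, integral_Ioi_rpow_of_lt hp hs]

/-- The running average `t ↦ t⁻¹ ∫₀ᵗ h` of a nonnegative function. -/
def runAvg (h : ℝ → ℝ≥0∞) (t : ℝ) : ℝ≥0∞ := ENNReal.ofReal t⁻¹ * ∫⁻ s in Ioc 0 t, h s

-- Cauchy-Schwarz for the splitting `h s = s ^ (-1/4) * (s ^ (1/4) * h s)`.
theorem sq_lintegral_Ioc_le {h : ℝ → ℝ≥0∞} (hm : Measurable h) {t : ℝ} (ht : 0 < t) :
    (∫⁻ s in Ioc 0 t, h s) ^ 2 ≤ ENNReal.ofReal (2 * t ^ (1 / 2 : ℝ)) *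
      ∫⁻ s in Ioc 0 t, ENNReal.ofReal (s ^ (1 / 2 : ℝ)) * h s ^ 2 := by
  have hsplit : ∫⁻ s in Ioc 0 t, h s = ∫⁻ s in Ioc 0 t, ENNReal.ofReal (s ^ (-(1 / 4) : ℝ)) *
      (ENNReal.ofReal (s ^ (1 / 4 : ℝ)) * h s) := by
    refine setLIntegral_congr_fun measurableSet_Ioc fun s hs => ?_
    rw [← mul_assoc, ← ENNReal.ofReal_mul (Real.rpow_nonneg hs.1.le _), ← Real.rpow_add hs.1]
    norm_num
  have hweight : ∫⁻ s in Ioc 0 t, ENNReal.ofReal (s ^ (-(1 / 4) : ℝ)) ^ 2 =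
      ENNReal.ofReal (2 * t ^ (1 / 2 : ℝ)) := by
    rw [setLIntegral_congr_fun measurableSet_Ioc fun s hs => ofReal_rpow_sq hs.1.le _,
      lintegral_Ioc_rpow ht (by norm_num)]
    congr 1
    ring_nf
  have hrest : ∫⁻ s in Ioc 0 t, (ENNReal.ofReal (s ^ (1 / 4 : ℝ)) * h s) ^ 2 =
      ∫⁻ s in Ioc 0 t, ENNReal.ofReal (s ^ (1 / 2 : ℝ)) * h s ^ 2 := by
    refine setLIntegral_congr_fun measurableSet_Ioc fun s hs => ?_
    rw [mul_pow, ofReal_rpow_sq hs.1.le]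
    norm_num
  rw [hsplit, ← hweight, ← hrest]
  exact sq_lintegral_mul_le _ (by fun_prop) (by fun_prop)

theorem runAvg_sq_le {h : ℝ → ℝ≥0∞} (hm : Measurable h) {t : ℝ} (ht : 0 < t) :
    runAvg h t ^ 2 ≤ ∫⁻ s in Ioc 0 t,
      ENNReal.ofReal (2 * t ^ (-(3 / 2) : ℝ)) * (ENNReal.ofReal (s ^ (1 / 2 : ℝ)) * h s ^ 2) := by
  have hconst : ENNReal.ofReal t⁻¹ ^ 2 * ENNReal.ofReal (2 * t ^ (1 / 2 : ℝ)) =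
      ENNReal.ofReal (2 * t ^ (-(3 / 2) : ℝ)) := by
    rw [← ENNReal.ofReal_pow (by positivity), ← ENNReal.ofReal_mul (by positivity),
      mul_left_comm, ← Real.rpow_neg_one, ← Real.rpow_natCast, ← Real.rpow_mul ht.le,
      ← Real.rpow_add ht]
    norm_num
  rw [runAvg, mul_pow, lintegral_const_mul _ (by fun_prop), ← hconst, mul_assoc]
  gcongr
  exact sq_lintegral_Ioc_le hm ht

theorem lintegral_Ioc_lintegral_Ioc {G : ℝ → ℝ → ℝ≥0∞} (hG : Measurable (Function.uncurry G))
    (c : ℝ) :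
    ∫⁻ t in Ioc 0 c, ∫⁻ s in Ioc 0 t, G t s = ∫⁻ s in Ioc 0 c, ∫⁻ t in Icc s c, G t s := by
  set T : Set (ℝ × ℝ) := {p | 0 < p.2 ∧ p.2 ≤ p.1 ∧ p.1 ≤ c} with hT
  have hTm : MeasurableSet T := by
    rw [hT]; measurability
  have hswap := lintegral_lintegral_swap (μ := (volume : Measure ℝ)) (ν := (volume : Measure ℝ))
    (f := fun t s => T.indicator (Function.uncurry G) (t, s)) (hG.indicator hTm).aemeasurable
  have hleft : ∫⁻ t in Ioc 0 c, ∫⁻ s in Ioc 0 t, G t s =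
      ∫⁻ t, ∫⁻ s, T.indicator (Function.uncurry G) (t, s) := by
    rw [← lintegral_indicator measurableSet_Ioc]
    refine lintegral_congr fun t => ?_
    rw [indicator_apply]
    split_ifs with ht
    · rw [← lintegral_indicator measurableSet_Ioc]
      refine lintegral_congr fun s => ?_
      simp only [indicator_apply, hT, mem_ofPred_eq, mem_Ioc, ht.2, and_true, Function.uncurry]
    · refine (lintegral_eq_zero_of_ae_eq_zero (Eventually.of_forall fun s => ?_)).symm
      exact indicator_of_notMem (fun h => ht ⟨h.1.trans_le h.2.1, h.2.2⟩) _
  have hright : ∫⁻ s in Ioc 0 c, ∫⁻ t in Icc s c, G t s =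
      ∫⁻ s, ∫⁻ t, T.indicator (Function.uncurry G) (t, s) := by
    rw [← lintegral_indicator measurableSet_Ioc]
    refine lintegral_congr fun s => ?_
    rw [indicator_apply]
    split_ifs with hs
    · rw [← lintegral_indicator measurableSet_Icc]
      refine lintegral_congr fun t => ?_
      simp only [indicator_apply, hT, mem_ofPred_eq, mem_Icc, hs.1, true_and, Function.uncurry]
    · refine (lintegral_eq_zero_of_ae_eq_zero (Eventually.of_forall fun t => ?_)).symm
      exact indicator_of_notMem (fun h => hs ⟨h.1, h.2.1.trans h.2.2⟩) _
  rw [hleft, hright, hswap]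

theorem lintegral_runAvg_sq_le {h : ℝ → ℝ≥0∞} (hm : Measurable h) (c : ℝ) :
    ∫⁻ t in Ioc 0 c, runAvg h t ^ 2 ≤ 4 * ∫⁻ s in Ioc 0 c, h s ^ 2 := by
  have hinner : ∀ s, 0 < s → ∫⁻ t in Ici s, ENNReal.ofReal (2 * t ^ (-(3 / 2) : ℝ)) *
      (ENNReal.ofReal (s ^ (1 / 2 : ℝ)) * h s ^ 2) = 4 * h s ^ 2 := fun s hs => by
    simp_rw [ENNReal.ofReal_mul zero_le_two]
    rw [lintegral_mul_const _ (by fun_prop), lintegral_const_mul _ (by fun_prop),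
      lintegral_Ici_rpow hs (by norm_num), ← mul_assoc, ← ENNReal.ofReal_mul zero_le_two,
      ← ENNReal.ofReal_mul' (by positivity)]
    congr 1
    have hcancel : s ^ (-(3 / 2) + 1 : ℝ) * s ^ (1 / 2 : ℝ) = 1 := by
      rw [← Real.rpow_add hs]; norm_num
    rw [show 2 * (-s ^ (-(3 / 2) + 1 : ℝ) / (-(3 / 2) + 1)) * s ^ (1 / 2 : ℝ) =
      4 * (s ^ (-(3 / 2) + 1 : ℝ) * s ^ (1 / 2 : ℝ)) by ring, hcancel]
    norm_num
  calc ∫⁻ t in Ioc 0 c, runAvg h t ^ 2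
      ≤ ∫⁻ t in Ioc 0 c, ∫⁻ s in Ioc 0 t, ENNReal.ofReal (2 * t ^ (-(3 / 2) : ℝ)) *
          (ENNReal.ofReal (s ^ (1 / 2 : ℝ)) * h s ^ 2) :=
        setLIntegral_mono' measurableSet_Ioc fun t ht => runAvg_sq_le hm ht.1
    _ = ∫⁻ s in Ioc 0 c, ∫⁻ t in Icc s c, ENNReal.ofReal (2 * t ^ (-(3 / 2) : ℝ)) *
          (ENNReal.ofReal (s ^ (1 / 2 : ℝ)) * h s ^ 2) :=
        lintegral_Ioc_lintegral_Ioc (by fun_prop) c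
    _ ≤ ∫⁻ s in Ioc 0 c, 4 * h s ^ 2 := setLIntegral_mono' measurableSet_Ioc fun s hs =>
        (lintegral_mono_set Icc_subset_Ici_self).trans_eq (hinner s hs.1)
    _ = 4 * ∫⁻ s in Ioc 0 c, h s ^ 2 := lintegral_const_mul _ (by fun_prop)

/-! ### Coordinates of Sobolev functions -/

/-- `L²(𝕊¹; ℝ)`, the space of the coordinates of an element of `L2`. -/
abbrev L2Real : Type := Lp ℝ 2 (volume : Measure Circ)

/-- The `i`-th coordinate of a plane-valued `L²` function. -/
def coord (i : Fin 2) : L2 →L[ℝ] L2Real :=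
  (EuclideanSpace.proj i : Plane →L[ℝ] ℝ).compLpL 2 volume

/-- The `i`-th coordinate of the `j`-th weak derivative of a Sobolev function. -/
def derivCoord {k : ℕ} (j : Fin (k + 1)) (i : Fin 2) : Sobolev k →L[ℝ] L2Real :=
  coord i ∘L PiLp.proj 2 (fun _ : Fin (k + 1) => L2) j ∘L (Sobolev k).subtypeL

theorem coord_ae (i : Fin 2) (u : L2) : coord i u =ᵐ[volume] fun x => u x i :=
  ContinuousLinearMap.coeFn_compLpL _ u

theorem derivCoord_ae {k : ℕ} (j : Fin (k + 1)) (i : Fin 2) (γ : Sobolev k) :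
    derivCoord j i γ =ᵐ[volume] fun x => (γ.1 j : Circ → Plane) x i := coord_ae i _

theorem integrable_L2Real (u : L2Real) : Integrable (u : Circ → ℝ) :=
  (Lp.memLp u).integrable one_le_two

theorem integral_smul_apply {ψ : Circ → ℝ} (hψ : Continuous ψ) (u : L2) (i : Fin 2) :
    (∫ x, ψ x • u x) i = ∫ x, ψ x * coord i u x := by
  have h := (EuclideanSpace.proj i : Plane →L[ℝ] ℝ).integral_comp_comm (integrable_smul_L2 hψ u)
  refine h.symm.trans (integral_congr_ae ?_)
  filter_upwards [coord_ae i u] with x hx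
  rw [hx]
  simp

theorem isWeakDeriv_iff {u v : L2} :
    IsWeakDeriv u v ↔ ∀ i, IsWeakDerivReal (coord i u) (coord i v) := by
  simp only [IsWeakDeriv, IsWeakDerivReal]
  rw [forall_comm]
  refine forall_congr' fun φ => ?_
  rw [forall_comm]
  refine forall_congr' fun hφ => ?_
  simp only [← integral_smul_apply hφ.continuous_circDeriv, ← integral_smul_apply hφ.continuous]
  rw [PiLp.ext_iff]
  simp only [PiLp.neg_apply]

theorem contRep_eq {u : L2} {g : Circ → Plane} (hg : Continuous g) (h : g =ᵐ[volume] u) :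
    contRep u = g := by
  have hex : ∃ g : Circ → Plane, Continuous g ∧ g =ᵐ[volume] u := ⟨g, hg, h⟩
  rw [contRep, dif_pos hex]
  exact (Continuous.ae_eq_iff_eq volume hex.choose_spec.1 hg).mp (hex.choose_spec.2.trans h.symm)

theorem IsWeakDeriv.contRep_spec {u v : L2} (h : IsWeakDeriv u v) :
    Continuous (contRep u) ∧ contRep u =ᵐ[volume] u ∧
      ∀ i : Fin 2, IsPrimitive (fun x => contRep u x i) (coord i v) := by
  choose w hw hwu using fun i =>
    (isWeakDeriv_iff.mp h i).exists_isPrimitive (Lp.memLp _) (integrable_L2Real _)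
  have hg : Continuous fun x => (WithLp.toLp 2 fun i => w i x : Plane) :=
    (PiLp.continuous_toLp 2 _).comp (continuous_pi fun i => (hw i).continuous (integrable_L2Real _))
  have hgu : (fun x => (WithLp.toLp 2 fun i => w i x : Plane)) =ᵐ[volume] u := by
    have hcoord : ∀ᵐ x, ∀ i, w i x = u x i :=
      ae_all_iff.mpr fun i => (hwu i).trans (coord_ae i u)
    filter_upwards [hcoord] with x hx
    ext i
    exact hx i
  rw [contRep_eq hg hgu]
  exact ⟨hg, hgu, hw⟩

theorem ae_coe {p : Circ → Prop} (h : ∀ᵐ x, p x) : ∀ᵐ s : ℝ, p (s : Circ) := by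
  have hunit : ∀ n : ℤ, ∀ᵐ s : ℝ, s ∈ Ioc (n : ℝ) (n + 1) → p (s : Circ) := fun n =>
    (ae_restrict_iff' measurableSet_Ioc).mp
      ((UnitAddCircle.measurePreserving_mk (n : ℝ)).quasiMeasurePreserving.ae h)
  filter_upwards [ae_all_iff.mpr hunit] with s hs
  refine hs (⌈s⌉ - 1) ⟨?_, ?_⟩
  · push_cast; linarith [Int.ceil_lt_add_one s]
  · push_cast; linarith [Int.le_ceil s]

theorem IsPrimitive.congr_ae {w v v' : Circ → ℝ} (hw : IsPrimitive w v) (h : v =ᵐ[volume] v') :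
    IsPrimitive w v' := fun a b => (hw a b).trans <| intervalIntegral.integral_congr_ae <| by
  filter_upwards [ae_coe h] with s hs _ using hs

section Curve

variable (γ η : Sobolev 2)

theorem continuous_val : Continuous (val γ) := (IsWeakDeriv.contRep_spec (γ.2 0)).1

theorem continuous_d1 : Continuous (d1 γ) := (IsWeakDeriv.contRep_spec (γ.2 1)).1

theorem val_ae : val γ =ᵐ[volume] γ.1 0 := (IsWeakDeriv.contRep_spec (γ.2 0)).2.1

theorem d1_ae : d1 γ =ᵐ[volume] γ.1 1 := (IsWeakDeriv.contRep_spec (γ.2 1)).2.1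

theorem continuous_val_apply (i : Fin 2) : Continuous fun x => val γ x i :=
  (EuclideanSpace.proj i : Plane →L[ℝ] ℝ).continuous.comp (continuous_val γ)

theorem continuous_d1_apply (i : Fin 2) : Continuous fun x => d1 γ x i :=
  (EuclideanSpace.proj i : Plane →L[ℝ] ℝ).continuous.comp (continuous_d1 γ)

theorem derivCoord_one_ae (i : Fin 2) : derivCoord 1 i γ =ᵐ[volume] fun x => d1 γ x i := by
  filter_upwards [derivCoord_ae 1 i γ, d1_ae γ] with x hcoord hd1
  rw [hcoord, hd1]

theorem isPrimitive_d1 (i : Fin 2) : IsPrimitive (fun x => d1 γ x i) (derivCoord 2 i γ) :=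
  (IsWeakDeriv.contRep_spec (γ.2 1)).2.2 i

theorem isPrimitive_val (i : Fin 2) : IsPrimitive (fun x => val γ x i) fun x => d1 γ x i :=
  ((IsWeakDeriv.contRep_spec (γ.2 0)).2.2 i).congr_ae (derivCoord_one_ae γ i)

theorem val_add : val (γ + η) = val γ + val η := by
  refine contRep_eq ((continuous_val γ).add (continuous_val η)) ?_
  filter_upwards [val_ae γ, val_ae η, Lp.coeFn_add (γ.1 0) (η.1 0)] with x h1 h2 h3
  rw [Pi.add_apply, h1, h2]
  exact h3.symm

theorem d1_add : d1 (γ + η) = d1 γ + d1 η := by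
  refine contRep_eq ((continuous_d1 γ).add (continuous_d1 η)) ?_
  filter_upwards [d1_ae γ, d1_ae η, Lp.coeFn_add (γ.1 1) (η.1 1)] with x h1 h2 h3
  rw [Pi.add_apply, h1, h2]
  exact h3.symm

theorem val_smul (c : ℝ) : val (c • γ) = c • val γ := by
  refine contRep_eq ((continuous_val γ).const_smul c) ?_
  filter_upwards [val_ae γ, Lp.coeFn_smul c (γ.1 0)] with x h1 h2
  rw [Pi.smul_apply, h1]
  exact h2.symm

theorem d1_smul (c : ℝ) : d1 (c • γ) = c • d1 γ := by
  refine contRep_eq ((continuous_d1 γ).const_smul c) ?_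
  filter_upwards [d1_ae γ, Lp.coeFn_smul c (γ.1 1)] with x h1 h2
  rw [Pi.smul_apply, h1]
  exact h2.symm

end Curve

instance isProbabilityMeasure_circ : IsProbabilityMeasure (volume : Measure Circ) :=
  ⟨UnitAddCircle.measure_univ⟩

theorem integral_norm_le_norm_Lp {α E : Type*} [MeasurableSpace α] {μ : Measure α}
    [IsProbabilityMeasure μ] [NormedAddCommGroup E] {p : ℝ≥0∞} (hp : 1 ≤ p) (u : Lp E p μ) :
    ∫ x, ‖u x‖ ∂μ ≤ ‖u‖ := by
  rw [integral_norm_eq_lintegral_enorm (Lp.aestronglyMeasurable u),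
    ← eLpNorm_one_eq_lintegral_enorm, Lp.norm_def]
  exact ENNReal.toReal_mono (Lp.eLpNorm_ne_top u)
    (eLpNorm_le_eLpNorm_of_exponent_le hp (Lp.aestronglyMeasurable u))

namespace IsPrimitive

variable {w v : Circ → ℝ}

theorem abs_sub_le_integral (hw : IsPrimitive w v) (hv : Integrable v) {a b r s : ℝ}
    (hr : r ∈ Icc a b) (hs : s ∈ Icc a b) :
    |w (s : Circ) - w (r : Circ)| ≤ ∫ t in a..b, |v (t : Circ)| := by
  wlog hrs : r ≤ s generalizing r s
  · rw [abs_sub_comm]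
    exact this hs hr (le_of_not_ge hrs)
  rw [hw]
  refine (intervalIntegral.abs_integral_le_integral_abs hrs).trans ?_
  exact intervalIntegral.integral_mono_interval hr.1 hrs hs.2
    (Eventually.of_forall fun _ => abs_nonneg _) (intervalIntegrable_coe hv.abs _ _)

theorem abs_sub_le (hw : IsPrimitive w v) (hv : Integrable v) (x y : Circ) :
    |w x - w y| ≤ ∫ z, |v z| := by
  obtain ⟨s, rfl⟩ := QuotientAddGroup.mk_surjective x
  obtain ⟨r, hr, rfl⟩ : y ∈ ((↑) : ℝ → Circ) '' Ioc s (s + 1) := by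
    rw [AddCircle.coe_image_Ioc_eq]; trivial
  have hle := hw.abs_sub_le_integral hv (Ioc_subset_Icc_self hr)
    (left_mem_Icc.mpr (le_add_of_nonneg_right zero_le_one))
  rwa [UnitAddCircle.intervalIntegral_preimage s fun z => |v z|] at hle

theorem abs_le (hw : IsPrimitive w v) (hv : Integrable v) (x : Circ) :
    |w x| ≤ (∫ z, |w z|) + ∫ z, |v z| := by
  have hwi : Integrable w :=
    (hw.continuous hv).integrable_of_hasCompactSupport (HasCompactSupport.of_compactSpace _)
  have hmean := integral_mono (integrable_const |w x|) (hwi.abs.add (integrable_const (∫ z, |v z|)))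
    fun y => sub_le_iff_le_add'.mp ((abs_sub_abs_le_abs_sub _ _).trans (hw.abs_sub_le hv x y))
  simpa [integral_add hwi.abs (integrable_const _)] using hmean

end IsPrimitive

theorem abs_d1_le (γ : Sobolev 2) (i : Fin 2) (x : Circ) :
    |d1 γ x i| ≤ ‖derivCoord 1 i γ‖ + ‖derivCoord 2 i γ‖ := by
  have hd1 : ∫ z, |d1 γ z i| = ∫ z, |derivCoord 1 i γ z| :=
    integral_congr_ae ((derivCoord_one_ae γ i).symm.fun_comp (|·|))
  calc |d1 γ x i| ≤ (∫ z, |d1 γ z i|) + ∫ z, |derivCoord 2 i γ z| :=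
        (isPrimitive_d1 γ i).abs_le (integrable_L2Real (derivCoord 2 i γ)) x
    _ = (∫ z, ‖derivCoord 1 i γ z‖) + ∫ z, ‖derivCoord 2 i γ z‖ := by
        simp only [hd1, Real.norm_eq_abs]
    _ ≤ ‖derivCoord 1 i γ‖ + ‖derivCoord 2 i γ‖ := by
        gcongr <;> exact integral_norm_le_norm_Lp one_le_two _

/-! ### Difference quotients -/

/-- The representative of `y - x` in `(-1/2, 1/2]`. -/
def signedDist (x y : Circ) : ℝ := (AddCircle.measurableEquivIoc 1 (-1 / 2) (y - x) : ℝ)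

theorem measurable_signedDist : Measurable fun p : Circ × Circ => signedDist p.1 p.2 :=
  measurable_subtype_coe.comp ((AddCircle.measurableEquivIoc 1 (-1 / 2)).measurable.comp
    (measurable_snd.sub measurable_fst))

theorem signedDist_coe {a b : ℝ} (h : b - a ∈ Ioc (-1 / 2 : ℝ) (1 / 2)) :
    signedDist (a : Circ) (b : Circ) = b - a := by
  have h' : b - a ∈ Ioc (-1 / 2 : ℝ) (-1 / 2 + 1) := ⟨h.1, by linarith [h.2]⟩
  rw [signedDist, ← AddCircle.coe_sub]
  exact congrArg Subtype.val (AddCircle.equivIoc_coe_eq (p := (1 : ℝ)) h')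

theorem dist_coe {a b : ℝ} (h : |b - a| ≤ 1 / 2) : dist (a : Circ) (b : Circ) = |b - a| := by
  rw [dist_comm, dist_eq_norm, ← AddCircle.coe_sub]
  exact (AddCircle.norm_coe_eq_abs_iff 1 one_ne_zero).mpr (by simpa using h)

theorem dist_coe_of_le {a b : ℝ} (hab : a ≤ b) (hb : b ≤ a + 1 / 2) :
    dist (a : Circ) (b : Circ) = b - a := by
  have habs := abs_of_nonneg (sub_nonneg.mpr hab)
  rw [dist_coe (by rw [habs]; linarith), habs]

/-- `b` is dominated by the averages of `|g|` over the arcs shorter than a half-circle. -/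
def IsAvgDominated (b : Circ × Circ → ℝ) (g : Circ → ℝ) : Prop :=
  ∀ r s : ℝ, r < s → s < r + 1 / 2 →
    |b ((r : Circ), (s : Circ))| ≤ (s - r)⁻¹ * ∫ t in r..s, |g (t : Circ)| ∧
    |b ((s : Circ), (r : Circ))| ≤ (s - r)⁻¹ * ∫ t in r..s, |g (t : Circ)|

theorem setLIntegral_Ioc_add (F : ℝ → ℝ≥0∞) (a c : ℝ) :
    ∫⁻ t in Ioc 0 c, F (a + t) = ∫⁻ s in Ioc a (a + c), F s := by
  have h := (measurePreserving_add_left (volume : Measure ℝ) a).setLIntegral_comp_emb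
    (measurableEmbedding_addLeft a) F (Ioc 0 c)
  rwa [image_const_add_Ioc, add_zero] at h

theorem setLIntegral_Ioc_sub (F : ℝ → ℝ≥0∞) (a c : ℝ) :
    ∫⁻ t in Ioc 0 c, F (a - t) = ∫⁻ s in Ioc (a - c) a, F s := by
  have h := (Measure.measurePreserving_sub_left (volume : Measure ℝ) a).setLIntegral_comp_emb
    (measurableEmbedding_subLeft a) F (Ioc 0 c)
  rwa [image_const_sub_Ioc, sub_zero, setLIntegral_congr Ico_ae_eq_Ioc] at h

theorem lintegral_circ_eq_add (F : Circ → ℝ≥0∞) (a : ℝ) :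
    ∫⁻ y, F y = (∫⁻ t in Ioc 0 (1 / 2 : ℝ), F ((a + t : ℝ) : Circ)) +
      ∫⁻ t in Ioc 0 (1 / 2 : ℝ), F ((a - t : ℝ) : Circ) := by
  rw [setLIntegral_Ioc_add (fun s : ℝ => F (s : Circ)) a (1 / 2),
    setLIntegral_Ioc_sub (fun s : ℝ => F (s : Circ)) a (1 / 2), add_comm,
    ← lintegral_union measurableSet_Ioc (Ioc_disjoint_Ioc_of_le le_rfl),
    Ioc_union_Ioc_eq_Ioc (by linarith) (by linarith),
    ← UnitAddCircle.lintegral_preimage (a - 1 / 2)]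
  congr 3
  ring

theorem enorm_le_runAvg {c t : ℝ} (ht : 0 < t) {g : ℝ → ℝ} (hg : IntervalIntegrable g volume 0 t)
    (h : |c| ≤ t⁻¹ * ∫ s in (0 : ℝ)..t, |g s|) : ‖c‖ₑ ≤ runAvg (fun s => ‖g s‖ₑ) t := by
  rw [runAvg, ← ofReal_integral_norm_eq_lintegral_enorm hg.1,
    ← ENNReal.ofReal_mul (by positivity), ← intervalIntegral.integral_of_le ht.le,
    Real.enorm_eq_ofReal_abs]
  exact ENNReal.ofReal_le_ofReal h

theorem lintegral_enorm_sq_le_of_avg {b g : ℝ → ℝ} {c : ℝ} (hgm : Measurable g)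
    (hg : ∀ t, IntervalIntegrable g volume 0 t)
    (h : ∀ t ∈ Ioo 0 c, |b t| ≤ t⁻¹ * ∫ s in (0 : ℝ)..t, |g s|) :
    ∫⁻ t in Ioc 0 c, ‖b t‖ₑ ^ 2 ≤ 4 * ∫⁻ t in Ioc 0 c, ‖g t‖ₑ ^ 2 := by
  refine le_trans ?_ (lintegral_runAvg_sq_le hgm.enorm c)
  rw [setLIntegral_congr Ioo_ae_eq_Ioc.symm, setLIntegral_congr Ioo_ae_eq_Ioc.symm]
  exact setLIntegral_mono' measurableSet_Ioo fun t ht =>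
    pow_le_pow_left' (enorm_le_runAvg ht.1 (hg t) (h t ht)) 2

namespace IsAvgDominated

variable {b : Circ × Circ → ℝ} {g : Circ → ℝ}

theorem swap (h : IsAvgDominated b g) : IsAvgDominated (fun p => b p.swap) g :=
  fun r s hrs hs => (h r s hrs hs).symm

theorem lintegral_le (h : IsAvgDominated b g) (hg : Integrable g) (hgm : Measurable g)
    (x : Circ) : ∫⁻ y, ‖b (x, y)‖ₑ ^ 2 ≤ 4 * ∫⁻ y, ‖g y‖ₑ ^ 2 := by
  induction x using QuotientAddGroup.induction_on with | H a => ?_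
  have : Measurable fun s : ℝ => (s : Circ) := AddCircle.measurable_mk'
  rw [lintegral_circ_eq_add _ a, lintegral_circ_eq_add (fun y => ‖g y‖ₑ ^ 2) a, mul_add]
  refine add_le_add
    (lintegral_enorm_sq_le_of_avg (g := fun s => g ((a + s : ℝ) : Circ)) (by fun_prop) ?_ ?_)
    (lintegral_enorm_sq_le_of_avg (g := fun s => g ((a - s : ℝ) : Circ)) (by fun_prop) ?_ ?_)
  · intro t
    simpa using (intervalIntegrable_coe hg a (a + t)).comp_add_left a
  · intro t ht
    have hle := (h a (a + t) (by linarith [ht.1]) (by linarith [ht.2])).1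
    rw [intervalIntegral.integral_comp_add_left (fun s : ℝ => |g (s : Circ)|), add_zero]
    rwa [add_sub_cancel_left] at hle
  · intro t
    simpa using (intervalIntegrable_coe hg a (a - t)).comp_sub_left a
  · intro t ht
    have hle := (h (a - t) a (by linarith [ht.1]) (by linarith [ht.2])).2
    rw [intervalIntegral.integral_comp_sub_left (fun s : ℝ => |g (s : Circ)|), sub_zero]
    rwa [sub_sub_cancel] at hle

end IsAvgDominated

theorem IsPrimitive.abs_taylor_le {u v g : Circ → ℝ} (hu : IsPrimitive u v) (hv : IsPrimitive v g)
    (hg : Integrable g) {a b c : ℝ} (hab : a ≤ b) (hc : c ∈ Icc a b) :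
    |u (b : Circ) - u (a : Circ) - (b - a) * v (c : Circ)| ≤
      (b - a) * ∫ t in a..b, |g (t : Circ)| := by
  have hcont : Continuous fun t : ℝ => v (t : Circ) :=
    (hv.continuous hg).comp (AddCircle.continuous_mk' 1)
  have herror : u (b : Circ) - u (a : Circ) - (b - a) * v (c : Circ) =
      ∫ t in a..b, (v (t : Circ) - v (c : Circ)) := by
    rw [intervalIntegral.integral_sub (hcont.intervalIntegrable _ _) (by simp), hu,
      intervalIntegral.integral_const, smul_eq_mul]
  have hle := intervalIntegral.norm_integral_le_of_norm_le_const (a := a) (b := b)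
    (f := fun t : ℝ => v (t : Circ) - v (c : Circ)) fun t ht => by
      rw [uIoc_of_le hab] at ht
      exact hv.abs_sub_le_integral hg hc ⟨ht.1.le, ht.2⟩
  rwa [abs_of_nonneg (sub_nonneg.mpr hab), mul_comm, ← herror] at hle

/-- The second order difference quotient `(γ(y) - γ(x) - (y - x) γ'(x)) / |y - x|²`. -/
def taylorQuot (i : Fin 2) (γ : Sobolev 2) (p : Circ × Circ) : ℝ :=
  (val γ p.2 i - val γ p.1 i - signedDist p.1 p.2 * d1 γ p.1 i) / dist p.1 p.2 ^ 2

/-- The difference quotient `(γ'(x) - γ'(y)) / |y - x|` of the derivative. -/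
def derivQuot (i : Fin 2) (γ : Sobolev 2) (p : Circ × Circ) : ℝ :=
  (d1 γ p.1 i - d1 γ p.2 i) / dist p.1 p.2

section Quotients

variable (i : Fin 2) (γ : Sobolev 2)

theorem measurable_taylorQuot : Measurable (taylorQuot i γ) := by
  have hval := (continuous_val_apply γ i).measurable
  have hd1 := (continuous_d1_apply γ i).measurable
  exact (((hval.comp measurable_snd).sub (hval.comp measurable_fst)).sub
    (measurable_signedDist.mul (hd1.comp measurable_fst))).div
    ((measurable_fst.dist measurable_snd).pow_const 2)

theorem measurable_derivQuot : Measurable (derivQuot i γ) := by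
  have hd1 := (continuous_d1_apply γ i).measurable
  exact ((hd1.comp measurable_fst).sub (hd1.comp measurable_snd)).div
    (measurable_fst.dist measurable_snd)

theorem isAvgDominated_taylorQuot : IsAvgDominated (taylorQuot i γ) (derivCoord 2 i γ) := by
  intro r s hrs hs
  have hpos : 0 < s - r := sub_pos.mpr hrs
  have htaylor : ∀ {c : ℝ}, c ∈ Icc r s → _ :=
    (isPrimitive_val γ i).abs_taylor_le (isPrimitive_d1 γ i)
      (integrable_L2Real (derivCoord 2 i γ)) hrs.le
  have hdiv : ∀ {n : ℝ}, |n| ≤ (s - r) * ∫ t in r..s, |derivCoord 2 i γ (t : Circ)| →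
      |n / (s - r) ^ 2| ≤ (s - r)⁻¹ * ∫ t in r..s, |derivCoord 2 i γ (t : Circ)| := by
    intro n hn
    rw [abs_div, abs_of_pos (by positivity : 0 < (s - r) ^ 2), div_le_iff₀ (by positivity)]
    refine hn.trans_eq ?_
    field_simp
  constructor <;> simp only [taylorQuot]
  · rw [signedDist_coe ⟨by linarith, by linarith⟩, dist_coe_of_le hrs.le hs.le]
    exact hdiv (htaylor (left_mem_Icc.mpr hrs.le))
  · rw [signedDist_coe ⟨by linarith, by linarith⟩, dist_comm, dist_coe_of_le hrs.le hs.le]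
    refine hdiv ?_
    rw [← abs_neg]
    convert htaylor (right_mem_Icc.mpr hrs.le) using 2
    ring

theorem isAvgDominated_derivQuot : IsAvgDominated (derivQuot i γ) (derivCoord 2 i γ) := by
  intro r s hrs hs
  have hpos : 0 < s - r := sub_pos.mpr hrs
  have hosc : ∀ {x y : ℝ}, x ∈ Icc r s → y ∈ Icc r s →
      |d1 γ (y : Circ) i - d1 γ (x : Circ) i| / (s - r) ≤
        (s - r)⁻¹ * ∫ t in r..s, |derivCoord 2 i γ (t : Circ)| := fun hx hy => by
    rw [div_eq_inv_mul]
    gcongr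
    exact (isPrimitive_d1 γ i).abs_sub_le_integral (integrable_L2Real (derivCoord 2 i γ)) hx hy
  have hr : r ∈ Icc r s := left_mem_Icc.mpr hrs.le
  have hs' : s ∈ Icc r s := right_mem_Icc.mpr hrs.le
  simp only [derivQuot, dist_comm (s : Circ), dist_coe_of_le hrs.le hs.le, abs_div,
    abs_of_pos hpos]
  exact ⟨hosc hs' hr, hosc hr hs'⟩

end Quotients

/-! ### Multiplication operators on the torus -/

/-- `L²(𝕊¹ × 𝕊¹; ℝ)`. -/
abbrev L2Torus : Type := Lp ℝ 2 (volume : Measure (Circ × Circ))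

theorem eLpNorm_two_sq {α E : Type*} [MeasurableSpace α] [NormedAddCommGroup E] {μ : Measure α}
    (f : α → E) : eLpNorm f 2 μ ^ 2 = ∫⁻ x, ‖f x‖ₑ ^ 2 ∂μ := by
  simpa using eLpNorm_nnreal_pow_eq_lintegral (f := f) (μ := μ) (p := 2) two_ne_zero

theorem lintegral_enorm_sq_eq {α E : Type*} [MeasurableSpace α] [NormedAddCommGroup E]
    {μ : Measure α} (f : Lp E 2 μ) : ∫⁻ x, ‖f x‖ₑ ^ 2 ∂μ = ENNReal.ofReal (‖f‖ ^ 2) := by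
  rw [← eLpNorm_two_sq, ENNReal.ofReal_pow (norm_nonneg _), Lp.norm_def,
    ENNReal.ofReal_toReal (Lp.eLpNorm_ne_top f)]

theorem eLpNorm_two_le_ofReal {α E : Type*} [MeasurableSpace α] [NormedAddCommGroup E]
    {μ : Measure α} {f : α → E} {K : ℝ} (hK : 0 ≤ K)
    (h : ∫⁻ x, ‖f x‖ₑ ^ 2 ∂μ ≤ ENNReal.ofReal (K ^ 2)) : eLpNorm f 2 μ ≤ ENNReal.ofReal K := by
  rw [← eLpNorm_two_sq, ENNReal.ofReal_pow hK] at h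
  exact (ENNReal.pow_right_strictMono two_ne_zero).le_iff_le.mp h

theorem ae_fst {α β : Type*} [MeasureSpace α] [MeasureSpace β]
    [SFinite (volume : Measure β)] {P : α → Prop} (h : ∀ᵐ x, P x) : ∀ᵐ p : α × β, P p.1 :=
  Measure.quasiMeasurePreserving_fst.ae h

theorem ae_snd {α β : Type*} [MeasureSpace α] [MeasureSpace β]
    [SFinite (volume : Measure β)] {P : β → Prop} (h : ∀ᵐ x, P x) : ∀ᵐ p : α × β, P p.2 :=
  Measure.quasiMeasurePreserving_snd.ae h

/-- A family of kernels `b_e(x, y)` on the torus depending linearly on a parameter `e`, with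
`sup_x (∫ |b_e(x, y)|² dy)^{1/2}` bounded by a multiple of `‖e‖`. -/
structure KernelFamily (E : Type*) [NormedAddCommGroup E] [NormedSpace ℝ E] where
  toFun : E → Circ × Circ → ℝ
  measurable : ∀ e, Measurable (toFun e)
  add : ∀ e e', ∀ᵐ p, toFun (e + e') p = toFun e p + toFun e' p
  smul : ∀ (c : ℝ) e, ∀ᵐ p, toFun (c • e) p = c * toFun e p
  bound : ℝ
  bound_nonneg : 0 ≤ bound
  lintegral_le : ∀ e x, ∫⁻ y, ‖toFun e (x, y)‖ₑ ^ 2 ≤ ENNReal.ofReal ((bound * ‖e‖) ^ 2)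

namespace KernelFamily

variable {E : Type*} [NormedAddCommGroup E] [NormedSpace ℝ E] (B : KernelFamily E)

theorem measurable_mul_fst (e : E) (u : L2Real) : Measurable fun p => B.toFun e p * u p.1 :=
  (B.measurable e).mul ((Lp.stronglyMeasurable u).measurable.comp measurable_fst)

theorem lintegral_mul_fst_le (e : E) (u : L2Real) :
    ∫⁻ p, ‖B.toFun e p * u p.1‖ₑ ^ 2 ≤ ENNReal.ofReal ((B.bound * ‖e‖ * ‖u‖) ^ 2) := by
  have := (Lp.stronglyMeasurable u).measurable
  have hB := B.measurable e
  rw [Measure.volume_eq_prod, lintegral_prod _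
    (((B.measurable_mul_fst e u).enorm.pow_const 2).aemeasurable)]
  calc ∫⁻ x, ∫⁻ y, ‖B.toFun e (x, y) * u x‖ₑ ^ 2
      = ∫⁻ x, (∫⁻ y, ‖B.toFun e (x, y)‖ₑ ^ 2) * ‖u x‖ₑ ^ 2 := by
        refine lintegral_congr fun x => ?_
        rw [← lintegral_mul_const _ (by fun_prop)]
        simp only [enorm_mul, mul_pow]
    _ ≤ ∫⁻ x, ENNReal.ofReal ((B.bound * ‖e‖) ^ 2) * ‖u x‖ₑ ^ 2 := by
        gcongr with x
        exact B.lintegral_le e x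
    _ = ENNReal.ofReal ((B.bound * ‖e‖ * ‖u‖) ^ 2) := by
        rw [lintegral_const_mul _ (by fun_prop), lintegral_enorm_sq_eq,
          ← ENNReal.ofReal_mul (by positivity), ← mul_pow]

theorem eLpNorm_mul_fst_le (e : E) (u : L2Real) :
    eLpNorm (fun p => B.toFun e p * u p.1) 2 volume ≤ ENNReal.ofReal (B.bound * ‖e‖ * ‖u‖) :=
  eLpNorm_two_le_ofReal (mul_nonneg (mul_nonneg B.bound_nonneg (norm_nonneg _)) (norm_nonneg _))
    (B.lintegral_mul_fst_le e u)

theorem memLp_mul_fst (e : E) (u : L2Real) : MemLp (fun p => B.toFun e p * u p.1) 2 volume :=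
  ⟨(B.measurable_mul_fst e u).aestronglyMeasurable,
    (B.eLpNorm_mul_fst_le e u).trans_lt ENNReal.ofReal_lt_top⟩

/-- The bilinear map `(e, u) ↦ b_e(x, y) u(x)`. -/
def lift : E →L[ℝ] L2Real →L[ℝ] L2Torus :=
  LinearMap.mkContinuous₂
    (LinearMap.mk₂ ℝ (fun e u => (B.memLp_mul_fst e u).toLp)
      (fun e e' u => by
        rw [← MemLp.toLp_add]
        refine MemLp.toLp_congr _ _ ?_
        filter_upwards [B.add e e'] with p hp
        rw [hp, Pi.add_apply]; ring)
      (fun c e u => by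
        rw [← MemLp.toLp_const_smul]
        refine MemLp.toLp_congr _ _ ?_
        filter_upwards [B.smul c e] with p hp
        rw [hp, Pi.smul_apply, smul_eq_mul]; ring)
      (fun e u u' => by
        rw [← MemLp.toLp_add]
        refine MemLp.toLp_congr _ _ ?_
        filter_upwards [ae_fst (Lp.coeFn_add u u')] with p hp
        rw [hp, Pi.add_apply, Pi.add_apply]; ring)
      (fun c e u => by
        rw [← MemLp.toLp_const_smul]
        refine MemLp.toLp_congr _ _ ?_
        filter_upwards [ae_fst (Lp.coeFn_smul c u)] with p hp
        rw [hp, Pi.smul_apply, Pi.smul_apply, smul_eq_mul, smul_eq_mul]; ring))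
    B.bound fun e u => by
      rw [LinearMap.mk₂_apply, Lp.norm_toLp]
      exact ENNReal.toReal_le_of_le_ofReal
        (mul_nonneg (mul_nonneg B.bound_nonneg (norm_nonneg _)) (norm_nonneg _))
        (B.eLpNorm_mul_fst_le e u)

theorem lift_ae (e : E) (u : L2Real) : B.lift e u =ᵐ[volume] fun p => B.toFun e p * u p.1 :=
  (B.memLp_mul_fst e u).coeFn_toLp

/-- The kernel family of a pointwise linear family of kernels dominated by averages of the second
derivative. -/
def ofIsAvgDominated (i : Fin 2) (b : Sobolev 2 → Circ × Circ → ℝ)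
    (hm : ∀ γ, Measurable (b γ)) (hadd : ∀ γ η p, b (γ + η) p = b γ p + b η p)
    (hsmul : ∀ (c : ℝ) γ p, b (c • γ) p = c * b γ p)
    (hdom : ∀ γ, IsAvgDominated (b γ) (derivCoord 2 i γ)) : KernelFamily (Sobolev 2) where
  toFun := b
  measurable := hm
  add e e' := Eventually.of_forall fun p => hadd e e' p
  smul c e := Eventually.of_forall fun p => hsmul c e p
  bound := 2 * ‖(derivCoord 2 i : Sobolev 2 →L[ℝ] L2Real)‖
  bound_nonneg := by positivity
  lintegral_le γ x := by
    refine ((hdom γ).lintegral_le (integrable_L2Real _)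
      (Lp.stronglyMeasurable _).measurable x).trans ?_
    rw [lintegral_enorm_sq_eq, show (4 : ℝ≥0∞) = ENNReal.ofReal 4 by simp,
      ← ENNReal.ofReal_mul (by norm_num), mul_assoc, mul_pow]
    norm_num only
    gcongr
    exact (derivCoord 2 i : Sobolev 2 →L[ℝ] L2Real).le_opNorm γ

end KernelFamily

section Linearity

variable (i : Fin 2) (c : ℝ) (γ η : Sobolev 2) (p : Circ × Circ)

theorem taylorQuot_add : taylorQuot i (γ + η) p = taylorQuot i γ p + taylorQuot i η p := by
  simp only [taylorQuot, val_add, d1_add, Pi.add_apply, PiLp.add_apply]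
  ring

theorem taylorQuot_smul : taylorQuot i (c • γ) p = c * taylorQuot i γ p := by
  simp only [taylorQuot, val_smul, d1_smul, Pi.smul_apply, PiLp.smul_apply, smul_eq_mul]
  ring

theorem derivQuot_add : derivQuot i (γ + η) p = derivQuot i γ p + derivQuot i η p := by
  simp only [derivQuot, d1_add, Pi.add_apply, PiLp.add_apply]
  ring

theorem derivQuot_smul : derivQuot i (c • γ) p = c * derivQuot i γ p := by
  simp only [derivQuot, d1_smul, Pi.smul_apply, PiLp.smul_apply, smul_eq_mul]
  ring

end Linearity

/-- The kernels `taylorQuot i γ (x, y)`. -/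
def taylorKernel (i : Fin 2) : KernelFamily (Sobolev 2) :=
  .ofIsAvgDominated i (taylorQuot i) (measurable_taylorQuot i) (taylorQuot_add i)
    (taylorQuot_smul i) (isAvgDominated_taylorQuot i)

/-- The transposed kernels `taylorQuot i γ (y, x)`. -/
def taylorKernelSwap (i : Fin 2) : KernelFamily (Sobolev 2) :=
  .ofIsAvgDominated i (fun γ p => taylorQuot i γ p.swap)
    (fun γ => (measurable_taylorQuot i γ).comp measurable_swap)
    (fun γ η _ => taylorQuot_add i γ η _) (fun c γ _ => taylorQuot_smul i c γ _)
    (fun γ => (isAvgDominated_taylorQuot i γ).swap)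

/-- The transposed kernels `derivQuot i γ (y, x)`. -/
def derivKernelSwap (i : Fin 2) : KernelFamily (Sobolev 2) :=
  .ofIsAvgDominated i (fun γ p => derivQuot i γ p.swap)
    (fun γ => (measurable_derivQuot i γ).comp measurable_swap)
    (fun γ η _ => derivQuot_add i γ η _) (fun c γ _ => derivQuot_smul i c γ _)
    (fun γ => (isAvgDominated_derivQuot i γ).swap)

/-- The kernels `(x, y) ↦ κ(y)` for `κ ∈ L²`. -/
def sndKernel : KernelFamily L2Real where
  toFun κ p := κ p.2
  measurable κ := (Lp.stronglyMeasurable κ).measurable.comp measurable_snd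
  add κ κ' := ae_snd (Lp.coeFn_add κ κ')
  smul c κ := ae_snd (Lp.coeFn_smul c κ)
  bound := 1
  bound_nonneg := zero_le_one
  lintegral_le κ x := by rw [lintegral_enorm_sq_eq, one_mul]

/-- The isometry `w ↦ w ∘ swap` of `L²(𝕊¹ × 𝕊¹)`. -/
def swapTorus : L2Torus →L[ℝ] L2Torus :=
  (Lp.compMeasurePreservingₗᵢ ℝ Prod.swap Measure.measurePreserving_swap).toContinuousLinearMap

theorem swapTorus_ae (w : L2Torus) : swapTorus w =ᵐ[volume] fun p => w p.swap :=
  Lp.coeFn_compMeasurePreserving w Measure.measurePreserving_swap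

/-- The set of pairs of distinct points. -/
abbrev OffDiag : Type := {p : Circ × Circ // p.1 ≠ p.2}

open Classical in
/-- Extension by zero to the diagonal. -/
def extend (a : OffDiag →ᵇ ℝ) (p : Circ × Circ) : ℝ := if h : p.1 ≠ p.2 then a ⟨p, h⟩ else 0

section Extend

variable (a : OffDiag →ᵇ ℝ)

theorem extend_of_ne {p : Circ × Circ} (h : p.1 ≠ p.2) : extend a p = a ⟨p, h⟩ := dif_pos h

theorem abs_extend_le (p : Circ × Circ) : |extend a p| ≤ ‖a‖ := by
  rw [extend]
  split_ifs with h
  · exact a.norm_coe_le_norm ⟨p, h⟩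
  · simp

theorem measurable_extend : Measurable (extend a) := by
  classical
  have hoff : MeasurableSet {p : Circ × Circ | p.1 ≠ p.2} :=
    (isOpen_ne_fun continuous_fst continuous_snd).measurableSet
  exact Measurable.dite (f := fun p : {p : Circ × Circ | p.1 ≠ p.2} => a p)
    a.continuous.measurable (measurable_const (a := (0 : ℝ))) hoff

theorem memLp_extend : MemLp (extend a) ∞ volume :=
  memLp_top_of_bound (measurable_extend a).aestronglyMeasurable ‖a‖
    (Eventually.of_forall (abs_extend_le a))

end Extend

/-- Extension by zero to the diagonal, as a map into `L^∞`. -/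
def extendLp : (OffDiag →ᵇ ℝ) →L[ℝ] Lp ℝ ∞ (volume : Measure (Circ × Circ)) :=
  LinearMap.mkContinuous
    { toFun := fun a => (memLp_extend a).toLp
      map_add' := fun a a' => by
        rw [← MemLp.toLp_add]
        refine MemLp.toLp_congr _ _ (Eventually.of_forall fun p => ?_)
        simp only [extend, Pi.add_apply, BoundedContinuousFunction.add_apply]
        split_ifs <;> simp
      map_smul' := fun c a => by
        rw [RingHom.id_apply, ← MemLp.toLp_const_smul]
        refine MemLp.toLp_congr _ _ (Eventually.of_forall fun p => ?_)
        simp only [extend, Pi.smul_apply, BoundedContinuousFunction.smul_apply]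
        split_ifs <;> simp }
    1 fun a => by
      rw [one_mul, LinearMap.coe_mk, AddHom.coe_mk, Lp.norm_toLp]
      refine ENNReal.toReal_le_of_le_ofReal (norm_nonneg a) ?_
      exact eLpNormEssSup_le_of_ae_bound (Eventually.of_forall (abs_extend_le a))

/-- Multiplication of `L²(𝕊¹ × 𝕊¹)` by bounded functions. -/
def mulBdd : (OffDiag →ᵇ ℝ) →L[ℝ] L2Torus →L[ℝ] L2Torus :=
  (ContinuousLinearMap.mul ℝ ℝ).holderL volume ∞ 2 2 ∘L extendLp

theorem mulBdd_ae (a : OffDiag →ᵇ ℝ) (w : L2Torus) :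
    mulBdd a w =ᵐ[volume] fun p => extend a p * w p := by
  filter_upwards [(ContinuousLinearMap.mul ℝ ℝ).coeFn_holder (r := 2) (extendLp a) w,
    (memLp_extend a).coeFn_toLp] with p hmul hext
  refine Eq.trans hmul ?_
  rw [ContinuousLinearMap.mul_apply']
  exact congrArg (· * w p) hext

/-- Passage to the adjoint, which is linear between real Hilbert spaces. -/
def adjointReal {E F : Type*} [NormedAddCommGroup E] [InnerProductSpace ℝ E] [CompleteSpace E]
    [NormedAddCommGroup F] [InnerProductSpace ℝ F] [CompleteSpace F] :
    (E →L[ℝ] F) →L[ℝ] F →L[ℝ] E :=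
  LinearMap.mkContinuous
    { toFun := fun A => ContinuousLinearMap.adjoint A
      map_add' := map_add _
      map_smul' := fun c A => map_smulₛₗ ContinuousLinearMap.adjoint c A }
    1 fun A => by
      rw [one_mul]
      exact (LinearIsometryEquiv.norm_map ContinuousLinearMap.adjoint A).le

/-- The function of `x` obtained by integrating `b_e(x, y) a(x, y) w(x, y)` over `y`. -/
def pairing {E : Type*} [NormedAddCommGroup E] [NormedSpace ℝ E] (B : KernelFamily E)
    (a : OffDiag →ᵇ ℝ) (e : E) (w : L2Torus) : L2Real := adjointReal (B.lift e) (mulBdd a w)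

section Pairing

variable {E : Type*} [NormedAddCommGroup E] [NormedSpace ℝ E] (B : KernelFamily E)
  (a : OffDiag →ᵇ ℝ) (e : E) (w : L2Torus) (u : L2Real)

theorem inner_lift_mulBdd_ae : (fun p => inner ℝ (B.lift e u p) (mulBdd a w p)) =ᵐ[volume]
    fun p => B.toFun e p * u p.1 * (extend a p * w p) := by
  filter_upwards [B.lift_ae e u, mulBdd_ae a w] with p hlift hmul
  rw [hlift, hmul, RCLike.inner_apply', RCLike.conj_to_real]

theorem integrable_pairing : Integrable fun p => B.toFun e p * u p.1 * (extend a p * w p) :=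
  (L2.integrable_inner (B.lift e u) (mulBdd a w)).congr (inner_lift_mulBdd_ae B a e w u)

theorem inner_pairing :
    inner ℝ u (pairing B a e w) = ∫ p, B.toFun e p * u p.1 * (extend a p * w p) :=
  (ContinuousLinearMap.adjoint_inner_right (B.lift e) u (mulBdd a w)).trans <|
    (L2.inner_def _ _).trans (integral_congr_ae (inner_lift_mulBdd_ae B a e w u))

end Pairing

/-! ### Smooth maps into the algebra of bounded continuous functions -/

/-- A pointwise linear and bounded family of continuous functions, as a continuous linear map. -/
def bddOfLinear {E X : Type*} [NormedAddCommGroup E] [NormedSpace ℝ E] [TopologicalSpace X]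
    (b : E → X → ℝ) (hc : ∀ e, Continuous (b e)) (hadd : ∀ e e' p, b (e + e') p = b e p + b e' p)
    (hsmul : ∀ (c : ℝ) e p, b (c • e) p = c * b e p) (M : ℝ) (hM : 0 ≤ M)
    (hb : ∀ e p, |b e p| ≤ M * ‖e‖) : E →L[ℝ] X →ᵇ ℝ :=
  LinearMap.mkContinuous
    { toFun := fun e => BoundedContinuousFunction.ofNormedAddCommGroup (b e) (hc e) (M * ‖e‖) (hb e)
      map_add' := fun e e' => by ext p; exact hadd e e' p
      map_smul' := fun c e => by ext p; exact hsmul c e p }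
    M fun e => BoundedContinuousFunction.norm_ofNormedAddCommGroup_le _
      (mul_nonneg hM (norm_nonneg _)) (hb e)

section BddAlgebra

variable {X : Type*} [TopologicalSpace X]

theorem isUnit_of_forall_le {s : X →ᵇ ℝ} {c : ℝ} (hc : 0 < c) (h : ∀ p, c ≤ s p) : IsUnit s := by
  have hpos : ∀ p, 0 < s p := fun p => hc.trans_le (h p)
  refine IsUnit.of_mul_eq_one (BoundedContinuousFunction.ofNormedAddCommGroup (fun p => (s p)⁻¹)
    (s.continuous.inv₀ fun p => (hpos p).ne') c⁻¹ fun p => ?_) ?_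
  · rw [Real.norm_of_nonneg (inv_nonneg.mpr (hpos p).le)]
    exact inv_anti₀ hc (h p)
  · ext p
    exact mul_inv_cancel₀ (hpos p).ne'

theorem ringInverse_apply {s : X →ᵇ ℝ} (h : IsUnit s) (p : X) : Ring.inverse s p = (s p)⁻¹ :=
  eq_inv_of_mul_eq_one_right <|
    congrArg (fun f : X →ᵇ ℝ => f p) (Ring.mul_inverse_cancel s h)

/-- The pointwise square root. -/
def bddSqrt (q : X →ᵇ ℝ) : X →ᵇ ℝ :=
  BoundedContinuousFunction.ofNormedAddCommGroup (fun p => √(q p)) q.continuous.sqrt √‖q‖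
    fun p => by
      rw [Real.norm_of_nonneg (Real.sqrt_nonneg _)]
      exact Real.sqrt_le_sqrt ((le_abs_self _).trans (q.norm_coe_le_norm p))

theorem eventually_bddSqrt_mul_self {s : X →ᵇ ℝ} {c : ℝ} (hc : 0 < c) (h : ∀ p, c ≤ s p) :
    ∀ᶠ x in 𝓝 s, bddSqrt (x * x) = x := by
  filter_upwards [Metric.ball_mem_nhds s hc] with x hx
  ext p
  refine Real.sqrt_mul_self ?_
  have hdist : |x p - s p| ≤ dist x s := by
    rw [← Real.dist_eq]
    exact BoundedContinuousFunction.dist_coe_le_dist p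
  linarith [h p, Metric.mem_ball.mp hx, abs_le.mp hdist]

-- The square root is the local inverse of squaring, whose derivative `2 s` is invertible.
theorem contDiffAt_bddSqrt {q : X →ᵇ ℝ} {c : ℝ} (hc : 0 < c) (h : ∀ p, c ≤ q p) :
    ContDiffAt ℝ ∞ bddSqrt q := by
  set s := bddSqrt q
  have hsc : ∀ p, √c ≤ s p := fun p => Real.sqrt_le_sqrt (h p)
  have hc' : 0 < √c := Real.sqrt_pos.mpr hc
  have hss : s * s = q := by
    ext p
    exact Real.mul_self_sqrt (hc.le.trans (h p))
  obtain ⟨u, hu⟩ := isUnit_of_forall_le hc' hsc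
  let f' : (X →ᵇ ℝ) ≃L[ℝ] (X →ᵇ ℝ) := ContinuousLinearEquiv.equivOfInverse
    ((2 : ℝ) • ContinuousLinearMap.mul ℝ (X →ᵇ ℝ) s)
    ((2⁻¹ : ℝ) • ContinuousLinearMap.mul ℝ (X →ᵇ ℝ) ↑u⁻¹)
    (fun x => by simp [← hu]) (fun x => by simp [← hu])
  have hsq : ContDiffAt ℝ ∞ (fun x : X →ᵇ ℝ => x * x) s := by fun_prop
  have hsq' : HasFDerivAt (fun x : X →ᵇ ℝ => x * x) (f' : (X →ᵇ ℝ) →L[ℝ] (X →ᵇ ℝ)) s := by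
    refine ((hasFDerivAt_id s).mul' (hasFDerivAt_id (𝕜 := ℝ) s)).congr_fderiv ?_
    ext x p
    simp [f', two_mul, mul_comm]
  have huniq := (hsq.hasStrictFDerivAt' hsq' (by simp)).localInverse_unique
    (eventually_bddSqrt_mul_self hc' hsc)
  have hinv := hsq.to_localInverse hsq' (by simp)
  simp only [hss] at hinv huniq
  exact hinv.congr_of_eventuallyEq huniq

theorem isUnit_bddSqrt {q : X →ᵇ ℝ} {c : ℝ} (hc : 0 < c) (h : ∀ p, c ≤ q p) :
    IsUnit (bddSqrt q) :=
  isUnit_of_forall_le (Real.sqrt_pos.mpr hc) fun p => Real.sqrt_le_sqrt (h p)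

/-- The inverse Euclidean norm `(a² + b²)^{-1/2}`, where it is bounded. -/
def invNorm (a b : X →ᵇ ℝ) : X →ᵇ ℝ := Ring.inverse (bddSqrt (a * a + b * b))

theorem le_mul_self_add_mul_self {a b : X →ᵇ ℝ} {c : ℝ} (h : ∀ p, c ≤ a p ^ 2 + b p ^ 2) (p : X) :
    c ≤ (a * a + b * b) p := by
  simpa [sq] using h p

theorem invNorm_apply {a b : X →ᵇ ℝ} {c : ℝ} (hc : 0 < c) (h : ∀ p, c ≤ a p ^ 2 + b p ^ 2)
    (p : X) : invNorm a b p = (√(a p ^ 2 + b p ^ 2))⁻¹ := by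
  rw [invNorm, ringInverse_apply (isUnit_bddSqrt hc (le_mul_self_add_mul_self h))]
  simp [bddSqrt, sq]

theorem contDiffOn_invNorm {E : Type*} [NormedAddCommGroup E] [NormedSpace ℝ E] {S : Set E}
    {a b : E → X →ᵇ ℝ} (ha : ContDiffOn ℝ ∞ a S) (hb : ContDiffOn ℝ ∞ b S)
    (h : ∀ e ∈ S, ∃ c > 0, ∀ p, c ≤ a e p ^ 2 + b e p ^ 2) :
    ContDiffOn ℝ ∞ (fun e => invNorm (a e) (b e)) S := by
  intro e he
  obtain ⟨c, hc, hcp⟩ := h e he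
  have hpos := le_mul_self_add_mul_self hcp
  obtain ⟨u, hu⟩ := isUnit_bddSqrt hc hpos
  have hinv : ContDiffAt ℝ ∞ Ring.inverse (bddSqrt (a e * a e + b e * b e)) :=
    hu ▸ contDiffAt_ringInverse ℝ u
  have hsum : ContDiffWithinAt ℝ ∞ (fun e => a e * a e + b e * b e) S e :=
    ((ha e he).mul (ha e he)).add ((hb e he).mul (hb e he))
  have hsqrt := (contDiffAt_bddSqrt hc hpos).comp_contDiffWithinAt (g := bddSqrt) e hsum
  exact hinv.comp_contDiffWithinAt e hsqrt

end BddAlgebra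

/-! ### The chord-arc condition -/

theorem exists_coe_abs_sub_le (x y : Circ) :
    ∃ a b : ℝ, (a : Circ) = x ∧ (b : Circ) = y ∧ |b - a| ≤ 1 / 2 := by
  induction x using QuotientAddGroup.induction_on with | H a => ?_
  obtain ⟨b, hb, rfl⟩ : y ∈ ((↑) : ℝ → Circ) '' Ioc (a - 1 / 2) (a - 1 / 2 + 1) := by
    rw [AddCircle.coe_image_Ioc_eq]; trivial
  exact ⟨a, b, rfl, rfl, abs_le.mpr ⟨by linarith [hb.1], by linarith [hb.2]⟩⟩

theorem norm_plane_eq (v : Plane) : ‖v‖ = √(v 0 ^ 2 + v 1 ^ 2) := by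
  simp [EuclideanSpace.norm_eq]

theorem norm_plane_le (v : Plane) : ‖v‖ ≤ |v 0| + |v 1| := by
  rw [norm_plane_eq, ← sq_abs (v 0), ← sq_abs (v 1)]
  exact Real.sqrt_le_iff.mpr ⟨by positivity,
    by nlinarith [mul_nonneg (abs_nonneg (v 0)) (abs_nonneg (v 1))]⟩

/-- A bound for the embedding of `H²` into `C¹` in the `i`-th coordinate. -/
def d1Bound (i : Fin 2) : ℝ :=
  ‖(derivCoord 1 i : Sobolev 2 →L[ℝ] L2Real)‖ + ‖(derivCoord 2 i : Sobolev 2 →L[ℝ] L2Real)‖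

theorem d1Bound_nonneg (i : Fin 2) : 0 ≤ d1Bound i := by
  rw [d1Bound]; positivity

theorem abs_d1_le_mul_norm (i : Fin 2) (γ : Sobolev 2) (x : Circ) :
    |d1 γ x i| ≤ d1Bound i * ‖γ‖ := by
  rw [d1Bound, add_mul]
  exact (abs_d1_le γ i x).trans
    (add_le_add (ContinuousLinearMap.le_opNorm _ _) (ContinuousLinearMap.le_opNorm _ _))

theorem abs_chord_le (i : Fin 2) (γ : Sobolev 2) (x y : Circ) :
    |chord γ x y i| ≤ d1Bound i * ‖γ‖ * dist x y := by
  obtain ⟨a, b, rfl, rfl, hab⟩ := exists_coe_abs_sub_le x y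
  rw [dist_coe hab, chord, PiLp.sub_apply, isPrimitive_val γ i]
  exact intervalIntegral.norm_integral_le_of_norm_le_const (f := fun t : ℝ => d1 γ (t : Circ) i)
    fun t _ => abs_d1_le_mul_norm i γ t

theorem norm_chord_le (γ : Sobolev 2) (x y : Circ) :
    ‖chord γ x y‖ ≤ (d1Bound 0 + d1Bound 1) * ‖γ‖ * dist x y := by
  linarith [norm_plane_le (chord γ x y), abs_chord_le 0 γ x y, abs_chord_le 1 γ x y]

/-- The `i`-th coordinate of `γ'(x)`. -/
def d1Fst (i : Fin 2) : Sobolev 2 →L[ℝ] OffDiag →ᵇ ℝ :=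
  bddOfLinear (fun γ p => d1 γ p.1.1 i)
    (fun γ => (continuous_d1_apply γ i).comp (continuous_fst.comp continuous_subtype_val))
    (fun γ η p => by simp [d1_add]) (fun c γ p => by simp [d1_smul])
    (d1Bound i) (d1Bound_nonneg i) fun γ p => abs_d1_le_mul_norm i γ p.1.1

/-- The `i`-th coordinate of `γ'(y)`. -/
def d1Snd (i : Fin 2) : Sobolev 2 →L[ℝ] OffDiag →ᵇ ℝ :=
  bddOfLinear (fun γ p => d1 γ p.1.2 i)
    (fun γ => (continuous_d1_apply γ i).comp (continuous_snd.comp continuous_subtype_val))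
    (fun γ η p => by simp [d1_add]) (fun c γ p => by simp [d1_smul])
    (d1Bound i) (d1Bound_nonneg i) fun γ p => abs_d1_le_mul_norm i γ p.1.2

/-- The `i`-th coordinate of `(γ(y) - γ(x)) / |y - x|`. -/
def chordQuot (i : Fin 2) : Sobolev 2 →L[ℝ] OffDiag →ᵇ ℝ :=
  bddOfLinear (fun γ p => chord γ p.1.1 p.1.2 i / dist p.1.1 p.1.2)
    (fun γ => by
      have hval := continuous_val_apply γ i
      refine Continuous.div ?_ (by fun_prop) fun p => dist_ne_zero.mpr p.2
      exact (hval.comp (continuous_snd.comp continuous_subtype_val)).sub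
        (hval.comp (continuous_fst.comp continuous_subtype_val)))
    (fun γ η p => by
      simp only [chord, val_add, Pi.add_apply, PiLp.sub_apply, PiLp.add_apply]; ring)
    (fun c γ p => by
      simp only [chord, val_smul, Pi.smul_apply, PiLp.sub_apply, PiLp.smul_apply, smul_eq_mul]
      ring)
    (d1Bound i) (d1Bound_nonneg i)
    fun γ p => by
      have hdist : 0 < dist p.1.1 p.1.2 := dist_pos.mpr p.2
      rw [abs_div, abs_of_pos hdist, div_le_iff₀ hdist]
      exact abs_chord_le i γ _ _

section Apply

variable (i : Fin 2) (γ : Sobolev 2) (p : OffDiag)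

theorem d1Fst_apply : d1Fst i γ p = d1 γ p.1.1 i := rfl

theorem d1Snd_apply : d1Snd i γ p = d1 γ p.1.2 i := rfl

theorem chordQuot_apply : chordQuot i γ p = chord γ p.1.1 p.1.2 i / dist p.1.1 p.1.2 := rfl

end Apply

instance nonempty_offDiag : Nonempty OffDiag :=
  have hdist : dist ((0 : ℝ) : Circ) ((1 / 2 : ℝ) : Circ) = |1 / 2 - 0| := dist_coe (by norm_num)
  ⟨⟨(((0 : ℝ) : Circ), ((1 / 2 : ℝ) : Circ)), dist_pos.mp (by rw [hdist]; norm_num)⟩⟩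

theorem chordArc_mul_dist_le (γ : Sobolev 2) {x y : Circ} (h : x ≠ y) :
    chordArc γ * dist x y ≤ ‖chord γ x y‖ := by
  have hbdd : BddBelow (Set.range fun p : {p : Circ × Circ // p.1 ≠ p.2} =>
      ‖val γ p.1.1 - val γ p.1.2‖ / dist p.1.1 p.1.2) :=
    ⟨0, by rintro _ ⟨p, rfl⟩; positivity⟩
  rw [chord, norm_sub_rev, ← le_div_iff₀ (dist_pos.mpr h)]
  exact ciInf_le hbdd ⟨(x, y), h⟩

theorem chord_sub (γ η : Sobolev 2) (x y : Circ) :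
    chord (γ - η) x y = chord γ x y - chord η x y := by
  have hval : val (γ - η) = val γ - val η := by
    rw [sub_eq_add_neg, ← neg_one_smul ℝ η, val_add, val_smul, neg_one_smul, ← sub_eq_add_neg]
  simp only [chord, hval, Pi.sub_apply]
  abel

theorem le_chordArc_add (γ η : Sobolev 2) :
    chordArc γ ≤ chordArc η + (d1Bound 0 + d1Bound 1) * ‖γ - η‖ := by
  rw [← sub_le_iff_le_add]
  refine le_ciInf fun p => ?_
  rw [le_div_iff₀ (dist_pos.mpr p.2), norm_sub_rev (val η p.1.1)]
  change _ ≤ ‖chord η p.1.1 p.1.2‖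
  have hchord := norm_chord_le (γ - η) p.1.1 p.1.2
  rw [chord_sub] at hchord
  linarith [chordArc_mul_dist_le γ p.2,
    norm_sub_norm_le (chord γ p.1.1 p.1.2) (chord η p.1.1 p.1.2)]

theorem continuous_chordArc : Continuous chordArc :=
  LipschitzWith.continuous <| LipschitzWith.of_le_add_mul
    ⟨d1Bound 0 + d1Bound 1, add_nonneg (d1Bound_nonneg 0) (d1Bound_nonneg 1)⟩ fun γ η => by
      rw [dist_eq_norm]
      exact le_chordArc_add γ η

theorem isOpen_V : IsOpen V := isOpen_lt continuous_const continuous_chordArc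

theorem sq_chordArc_le_chordQuot {γ : Sobolev 2} (hγ : γ ∈ V) (p : OffDiag) :
    chordArc γ ^ 2 ≤ chordQuot 0 γ p ^ 2 + chordQuot 1 γ p ^ 2 := by
  have hpos : 0 < chordArc γ := hγ
  have hdist : 0 < dist p.1.1 p.1.2 := dist_pos.mpr p.2
  have hle := chordArc_mul_dist_le γ p.2
  rw [norm_plane_eq] at hle
  rw [chordQuot_apply, chordQuot_apply, div_pow, div_pow, ← add_div,
    le_div_iff₀ (by positivity), ← mul_pow]
  exact (Real.le_sqrt (by positivity) (by positivity)).mp hle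

theorem IsPrimitive.hasDerivAt {w v : Circ → ℝ} (hw : IsPrimitive w v) (hv : Continuous v)
    (s : ℝ) : HasDerivAt (fun t : ℝ => w (t : Circ)) (v (s : Circ)) s := by
  have hcont : Continuous fun t : ℝ => v (t : Circ) := hv.comp (AddCircle.continuous_mk' 1)
  have h := (hcont.integral_hasStrictDerivAt 0 s).hasDerivAt.const_add (w ((0 : ℝ) : Circ))
  simpa only [← hw 0, add_sub_cancel] using h

theorem sq_chordArc_le_d1 {γ : Sobolev 2} (hγ : γ ∈ V) (x : Circ) :
    chordArc γ ^ 2 ≤ d1 γ x 0 ^ 2 + d1 γ x 1 ^ 2 := by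
  have hpos : 0 < chordArc γ := hγ
  induction x using QuotientAddGroup.induction_on with | H s => ?_
  have hslope := fun i => ((isPrimitive_val γ i).hasDerivAt
    (continuous_d1_apply γ i) s).tendsto_slope
  refine ge_of_tendsto (((hslope 0).pow 2).add ((hslope 1).pow 2)) ?_
  have hnear : ∀ᶠ t in 𝓝[≠] s, |t - s| ≤ 1 / 2 :=
    nhdsWithin_le_nhds (Metric.closedBall_mem_nhds s one_half_pos)
  filter_upwards [hnear, self_mem_nhdsWithin] with t ht hne
  have hts : 0 < |t - s| := abs_pos.mpr (sub_ne_zero.mpr hne)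
  have hdist := dist_coe ht
  have hle := chordArc_mul_dist_le γ (dist_pos.mp (hdist ▸ hts))
  rw [norm_plane_eq, hdist, Real.le_sqrt (by positivity) (by positivity), mul_pow, sq_abs] at hle
  simp only [slope_def_field]
  rwa [div_pow, div_pow, ← add_div, le_div_iff₀ (by rw [← sq_abs]; positivity)]

/-! ### Maps into `L²` represented by densities on the torus -/

/-- `F` is smooth on `S`, and `F e` is the integral in `y` of the density `H e (x, y)`, in the sense
of distributions. -/
structure IsSmoothDensity {E : Type*} [NormedAddCommGroup E] [NormedSpace ℝ E] (S : Set E)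
    (F : E → L2Real) (H : E → Circ × Circ → ℝ) : Prop where
  contDiffOn : ContDiffOn ℝ ∞ F S
  integrable : ∀ e ∈ S, ∀ φ : Circ → ℝ, Continuous φ → Integrable fun p => φ p.1 * H e p
  integral_eq : ∀ e ∈ S, ∀ φ : Circ → ℝ, Continuous φ →
    ∫ x, φ x * F e x = ∫ p, φ p.1 * H e p

namespace IsSmoothDensity

variable {E : Type*} [NormedAddCommGroup E] [NormedSpace ℝ E] {S : Set E}
  {F F' : E → L2Real} {H H' : E → Circ × Circ → ℝ}

theorem zero : IsSmoothDensity S (fun _ => 0) fun _ _ => 0 where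
  contDiffOn := contDiffOn_const
  integrable _ _ φ _ := by simp
  integral_eq _ _ φ _ := by
    simp only [mul_zero, integral_zero]
    refine integral_eq_zero_of_ae ?_
    filter_upwards [Lp.coeFn_zero ℝ 2 (volume : Measure Circ)] with x hx
    rw [hx, Pi.zero_apply, mul_zero]

theorem add (h : IsSmoothDensity S F H) (h' : IsSmoothDensity S F' H') :
    IsSmoothDensity S (fun e => F e + F' e) (fun e p => H e p + H' e p) where
  contDiffOn := h.contDiffOn.add h'.contDiffOn
  integrable e he φ hφ := by
    simp_rw [mul_add]
    exact (h.integrable e he φ hφ).add (h'.integrable e he φ hφ)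
  integral_eq e he φ hφ := by
    simp_rw [mul_add]
    rw [integral_add (h.integrable e he φ hφ) (h'.integrable e he φ hφ),
      ← h.integral_eq e he φ hφ, ← h'.integral_eq e he φ hφ,
      ← integral_add (continuous_mul_integrable hφ (integrable_L2Real _))
        (continuous_mul_integrable hφ (integrable_L2Real _))]
    refine integral_congr_ae ?_
    filter_upwards [Lp.coeFn_add (F e) (F' e)] with x hx
    rw [hx, Pi.add_apply, mul_add]

theorem sum {ι : Type*} {s : Finset ι} {F : ι → E → L2Real} {H : ι → E → Circ × Circ → ℝ}
    (h : ∀ i ∈ s, IsSmoothDensity S (F i) (H i)) :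
    IsSmoothDensity S (fun e => ∑ i ∈ s, F i e) (fun e p => ∑ i ∈ s, H i e p) := by
  classical
  induction s using Finset.induction_on with
  | empty => simpa only [Finset.sum_empty] using zero
  | insert i s hi ih =>
    simp only [Finset.sum_insert hi]
    exact (h i (Finset.mem_insert_self i s)).add
      (ih fun j hj => h j (Finset.mem_insert_of_mem hj))

theorem const_smul (h : IsSmoothDensity S F H) (c : ℝ) :
    IsSmoothDensity S (fun e => c • F e) (fun e p => c * H e p) where
  contDiffOn := h.contDiffOn.const_smul c
  integrable e he φ hφ := by
    simp_rw [mul_left_comm]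
    exact (h.integrable e he φ hφ).const_mul c
  integral_eq e he φ hφ := by
    simp_rw [mul_left_comm]
    rw [integral_const_mul, ← h.integral_eq e he φ hφ, ← integral_const_mul]
    refine integral_congr_ae ?_
    filter_upwards [Lp.coeFn_smul c (F e)] with x hx
    rw [hx, Pi.smul_apply, smul_eq_mul, mul_left_comm]

theorem of_pairing {G : Type*} [NormedAddCommGroup G] [NormedSpace ℝ G] (B : KernelFamily G)
    {a : E → OffDiag →ᵇ ℝ} {g : E → G} {w : E → L2Torus} (ha : ContDiffOn ℝ ∞ a S)
    (hg : ContDiffOn ℝ ∞ g S) (hw : ContDiffOn ℝ ∞ w S)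
    (hH : ∀ e, H e =ᵐ[volume] fun p => extend (a e) p * (B.toFun (g e) p * w e p)) :
    IsSmoothDensity S (fun e => pairing B (a e) (g e) (w e)) H := by
  have memLp_continuous : ∀ {φ : Circ → ℝ}, Continuous φ → MemLp φ 2 := fun hφ =>
    hφ.memLp_of_hasCompactSupport (HasCompactSupport.of_compactSpace _)
  have density_ae : ∀ e {φ : Circ → ℝ} (hφ : Continuous φ),
      (fun p => B.toFun (g e) p * (memLp_continuous hφ).toLp φ p.1 * (extend (a e) p * w e p))
        =ᵐ[volume] fun p => φ p.1 * H e p := by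
    intro e φ hφ
    filter_upwards [hH e, ae_fst (memLp_continuous hφ).coeFn_toLp] with p hp hp'
    rw [hp, hp']; ring
  refine ⟨?_, fun e _ φ hφ => ?_, fun e _ φ hφ => ?_⟩
  · exact (adjointReal.contDiff.comp_contDiffOn (B.lift.contDiff.comp_contDiffOn hg)).clm_apply
      ((mulBdd.contDiff.comp_contDiffOn ha).clm_apply hw)
  · exact (integrable_pairing B (a e) (g e) (w e) _).congr (density_ae e hφ)
  · rw [← integral_congr_ae (density_ae e hφ), ← inner_pairing, L2.inner_def]
    refine integral_congr_ae ?_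
    filter_upwards [(memLp_continuous hφ).coeFn_toLp] with x hx
    rw [hx, RCLike.inner_apply', RCLike.conj_to_real]

end IsSmoothDensity

theorem contDiffOn_lift {E G : Type*} [NormedAddCommGroup E] [NormedSpace ℝ E]
    [NormedAddCommGroup G] [NormedSpace ℝ G] {S : Set E} (B : KernelFamily G) {g : E → G}
    {u : E → L2Real} (hg : ContDiffOn ℝ ∞ g S) (hu : ContDiffOn ℝ ∞ u S) :
    ContDiffOn ℝ ∞ (fun e => B.lift (g e) (u e)) S :=
  (B.lift.contDiff.comp_contDiffOn hg).clm_apply hu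

theorem swapTorus_lift_ae {E : Type*} [NormedAddCommGroup E] [NormedSpace ℝ E]
    (B : KernelFamily E) (e : E) (u : L2Real) :
    swapTorus (B.lift e u) =ᵐ[volume] fun p => B.toFun e p.swap * u p.2 := by
  have hlift : ∀ᵐ p : Circ × Circ, B.lift e u p.swap = B.toFun e p.swap * u p.swap.1 :=
    (Measure.measurePreserving_swap (μ := volume)
      (ν := volume)).quasiMeasurePreserving.ae (B.lift_ae e u)
  filter_upwards [swapTorus_ae (B.lift e u), hlift] with p hswap hp
  rw [hswap, hp, Prod.fst_swap]

/-- The constant function `1` in `L²`. -/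
def oneLp : L2Real := (memLp_const (1 : ℝ)).toLp fun _ => (1 : ℝ)

theorem oneLp_ae : oneLp =ᵐ[volume] fun _ => (1 : ℝ) := (memLp_const (1 : ℝ)).coeFn_toLp

/-! ### The forcing and its derivative as smooth maps into `L²` -/

/-- The rotation taking the tangent to the normal. -/
def rot : Matrix (Fin 2) (Fin 2) ℝ := !![0, 1; -1, 0]

/-- The `i`-th coordinate of the rotated tangent `|γ'(x)| ν(x)`. -/
def normalFst (i : Fin 2) (γ : Sobolev 2) : OffDiag →ᵇ ℝ := ∑ k, rot i k • d1Fst k γ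

/-- The `i`-th coordinate of the rotated tangent `|γ'(y)| ν(y)`. -/
def normalSnd (i : Fin 2) (γ : Sobolev 2) : OffDiag →ᵇ ℝ := ∑ k, rot i k • d1Snd k γ

/-- The inverse speed `|γ'(x)|⁻¹`. -/
def invSpeedFst (γ : Sobolev 2) : OffDiag →ᵇ ℝ := invNorm (d1Fst 0 γ) (d1Fst 1 γ)

/-- The inverse speed `|γ'(y)|⁻¹`. -/
def invSpeedSnd (γ : Sobolev 2) : OffDiag →ᵇ ℝ := invNorm (d1Snd 0 γ) (d1Snd 1 γ)

/-- The quotient `|y - x| / |γ(y) - γ(x)|`. -/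
def invChordQuot (γ : Sobolev 2) : OffDiag →ᵇ ℝ := invNorm (chordQuot 0 γ) (chordQuot 1 γ)

/-- The product of `chordQuot` with the rotated tangent at `y`. -/
def normalSndDotChordQuot (γ : Sobolev 2) : OffDiag →ᵇ ℝ := ∑ k, normalSnd k γ * chordQuot k γ

/-- The product of `chordQuot` with the tangent at `x`. -/
def d1FstDotChordQuot (γ : Sobolev 2) : OffDiag →ᵇ ℝ := ∑ k, d1Fst k γ * chordQuot k γ

/-- The factor common to the coefficients of the forcing and of its derivative. -/
def commonCoeff (l : Fin 2) (γ : Sobolev 2) : OffDiag →ᵇ ℝ :=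
  normalSnd l γ * invSpeedSnd γ ^ 3 * invChordQuot γ ^ 3

/-- The coefficient of `γ_l''(y) taylorQuot i γ (x, y)` in `forceDensity j γ`. -/
def forceCoeff (j l i : Fin 2) (γ : Sobolev 2) : OffDiag →ᵇ ℝ :=
  commonCoeff l γ * invSpeedFst γ ^ 2 * normalFst j γ * normalFst i γ * normalSndDotChordQuot γ

/-- The coefficient of `γ_l''(y) γ_m''(x) taylorQuot i γ (x, y)` in `forceDerivDensity j γ`. -/
def accelCoeff (j l m i : Fin 2) (γ : Sobolev 2) : OffDiag →ᵇ ℝ :=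
  commonCoeff l γ * normalFst i γ * normalSndDotChordQuot γ *
    (rot j m • invSpeedFst γ ^ 2 - (2 : ℝ) • (invSpeedFst γ ^ 4 * d1Fst m γ * normalFst j γ))

/-- The coefficient of `γ_l''(y) γ_m''(x) taylorQuot i γ (y, x)` in `forceDerivDensity j γ`. -/
def accelSwapCoeff (j l m i : Fin 2) (γ : Sobolev 2) : OffDiag →ᵇ ℝ :=
  -(commonCoeff l γ * invSpeedFst γ ^ 2 * normalFst j γ * (∑ k, rot k m • chordQuot k γ) *
    normalSnd i γ)

/-- The coefficient of `γ_l''(y) taylorQuot i γ (x, y) derivQuot k γ (x, y)` in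
`forceDerivDensity j γ`. -/
def derivQuotCoeff (j l i k : Fin 2) (γ : Sobolev 2) : OffDiag →ᵇ ℝ :=
  -(commonCoeff l γ * invSpeedFst γ ^ 2 * normalFst j γ * normalFst i γ * normalSnd k γ)

/-- The coefficient of `γ_l''(y) taylorQuot i γ (x, y) taylorQuot k γ (y, x)` in
`forceDerivDensity j γ`. -/
def taylorQuotCoeff (j l i k : Fin 2) (γ : Sobolev 2) : OffDiag →ᵇ ℝ :=
  -((3 : ℝ) • (commonCoeff l γ * invSpeedFst γ ^ 2 * normalFst j γ * normalFst i γ *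
    normalSnd k γ * d1FstDotChordQuot γ * invChordQuot γ ^ 2))

section ContDiffOn

variable (i j k l m : Fin 2)

@[fun_prop]
theorem contDiffOn_normalFst : ContDiffOn ℝ ∞ (normalFst i) V := by
  unfold normalFst; fun_prop

@[fun_prop]
theorem contDiffOn_normalSnd : ContDiffOn ℝ ∞ (normalSnd i) V := by
  unfold normalSnd; fun_prop

@[fun_prop]
theorem contDiffOn_invSpeedFst : ContDiffOn ℝ ∞ invSpeedFst V :=
  contDiffOn_invNorm (by fun_prop) (by fun_prop) fun γ hγ =>
    ⟨chordArc γ ^ 2, pow_pos hγ 2, fun p => sq_chordArc_le_d1 hγ p.1.1⟩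

@[fun_prop]
theorem contDiffOn_invSpeedSnd : ContDiffOn ℝ ∞ invSpeedSnd V :=
  contDiffOn_invNorm (by fun_prop) (by fun_prop) fun γ hγ =>
    ⟨chordArc γ ^ 2, pow_pos hγ 2, fun p => sq_chordArc_le_d1 hγ p.1.2⟩

@[fun_prop]
theorem contDiffOn_invChordQuot : ContDiffOn ℝ ∞ invChordQuot V :=
  contDiffOn_invNorm (by fun_prop) (by fun_prop) fun γ hγ =>
    ⟨chordArc γ ^ 2, pow_pos hγ 2, fun p => sq_chordArc_le_chordQuot hγ p⟩

@[fun_prop]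
theorem contDiffOn_normalSndDotChordQuot : ContDiffOn ℝ ∞ normalSndDotChordQuot V := by
  unfold normalSndDotChordQuot; fun_prop

@[fun_prop]
theorem contDiffOn_d1FstDotChordQuot : ContDiffOn ℝ ∞ d1FstDotChordQuot V := by
  unfold d1FstDotChordQuot; fun_prop

@[fun_prop]
theorem contDiffOn_commonCoeff : ContDiffOn ℝ ∞ (commonCoeff l) V := by
  unfold commonCoeff; fun_prop

theorem contDiffOn_forceCoeff : ContDiffOn ℝ ∞ (forceCoeff j l i) V := by
  unfold forceCoeff; fun_prop

theorem contDiffOn_accelCoeff : ContDiffOn ℝ ∞ (accelCoeff j l m i) V := by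
  unfold accelCoeff; fun_prop

theorem contDiffOn_accelSwapCoeff : ContDiffOn ℝ ∞ (accelSwapCoeff j l m i) V := by
  unfold accelSwapCoeff; fun_prop

theorem contDiffOn_derivQuotCoeff : ContDiffOn ℝ ∞ (derivQuotCoeff j l i k) V := by
  unfold derivQuotCoeff; fun_prop

theorem contDiffOn_taylorQuotCoeff : ContDiffOn ℝ ∞ (taylorQuotCoeff j l i k) V := by
  unfold taylorQuotCoeff; fun_prop

end ContDiffOn

/-- The `j`-th coordinate of the forcing, as an element of `L²`. -/
def forceLp (j : Fin 2) (γ : Sobolev 2) : L2Real := (1 / (2 * Real.pi)) • ∑ l, ∑ i,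
  pairing sndKernel (forceCoeff j l i γ) (derivCoord 2 l γ) ((taylorKernel i).lift γ oneLp)

/-- The density of `forceLp`. -/
def forceDensity (j : Fin 2) (γ : Sobolev 2) (p : Circ × Circ) : ℝ :=
  (1 / (2 * Real.pi)) * ∑ l, ∑ i,
    extend (forceCoeff j l i γ) p * (derivCoord 2 l γ p.2 * taylorQuot i γ p)

/-- The `j`-th coordinate of the derivative of the forcing, as an element of `L²`. -/
def forceDerivLp (j : Fin 2) (γ : Sobolev 2) : L2Real := (1 / (2 * Real.pi)) • ∑ l,
  ((∑ m, ∑ i,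
      (pairing sndKernel (accelCoeff j l m i γ) (derivCoord 2 l γ)
          ((taylorKernel i).lift γ (derivCoord 2 m γ)) +
        pairing sndKernel (accelSwapCoeff j l m i γ) (derivCoord 2 l γ)
          ((taylorKernelSwap i).lift γ (derivCoord 2 m γ)))) +
    ∑ i, ∑ k,
      (pairing (taylorKernel i) (derivQuotCoeff j l i k γ) γ
          (swapTorus ((derivKernelSwap k).lift γ (derivCoord 2 l γ))) +
        pairing (taylorKernel i) (taylorQuotCoeff j l i k γ) γ
          (swapTorus ((taylorKernel k).lift γ (derivCoord 2 l γ)))))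

/-- The density of `forceDerivLp`. -/
def forceDerivDensity (j : Fin 2) (γ : Sobolev 2) (p : Circ × Circ) : ℝ :=
  (1 / (2 * Real.pi)) * ∑ l,
    ((∑ m, ∑ i,
        (extend (accelCoeff j l m i γ) p *
            (derivCoord 2 l γ p.2 * (taylorQuot i γ p * derivCoord 2 m γ p.1)) +
          extend (accelSwapCoeff j l m i γ) p *
            (derivCoord 2 l γ p.2 * (taylorQuot i γ p.swap * derivCoord 2 m γ p.1)))) +
      ∑ i, ∑ k,
        (extend (derivQuotCoeff j l i k γ) p *
            (taylorQuot i γ p * (derivQuot k γ p * derivCoord 2 l γ p.2)) +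
          extend (taylorQuotCoeff j l i k γ) p *
            (taylorQuot i γ p * (taylorQuot k γ p.swap * derivCoord 2 l γ p.2))))

theorem isSmoothDensity_forceLp (j : Fin 2) :
    IsSmoothDensity V (forceLp j) (forceDensity j) := by
  refine .const_smul (.sum fun l _ => .sum fun i _ => ?_) _
  refine .of_pairing sndKernel (contDiffOn_forceCoeff i j l) (by fun_prop)
    (contDiffOn_lift _ contDiffOn_id contDiffOn_const) fun γ => ?_
  filter_upwards [(taylorKernel i).lift_ae γ oneLp, ae_fst oneLp_ae] with p hlift hone
  rw [hlift, hone, mul_one]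
  rfl

theorem isSmoothDensity_forceDerivLp (j : Fin 2) :
    IsSmoothDensity V (forceDerivLp j) (forceDerivDensity j) := by
  have hlift : ∀ (B : KernelFamily (Sobolev 2)) l,
      ContDiffOn ℝ ∞ (fun γ => B.lift γ (derivCoord 2 l γ)) V := fun B l =>
    contDiffOn_lift B contDiffOn_id (by fun_prop)
  have hswap : ∀ (B : KernelFamily (Sobolev 2)) l,
      ContDiffOn ℝ ∞ (fun γ => swapTorus (B.lift γ (derivCoord 2 l γ))) V := fun B l =>
    swapTorus.contDiff.comp_contDiffOn (hlift B l)
  refine .const_smul (.sum fun l _ => .add (.sum fun m _ => .sum fun i _ => .add ?_ ?_)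
    (.sum fun i _ => .sum fun k _ => .add ?_ ?_)) _
  · refine .of_pairing sndKernel (contDiffOn_accelCoeff i j l m) (by fun_prop) (hlift _ m)
      fun γ => ?_
    filter_upwards [(taylorKernel i).lift_ae γ (derivCoord 2 m γ)] with p hp
    rw [hp]
    rfl
  · refine .of_pairing sndKernel (contDiffOn_accelSwapCoeff i j l m) (by fun_prop) (hlift _ m)
      fun γ => ?_
    filter_upwards [(taylorKernelSwap i).lift_ae γ (derivCoord 2 m γ)] with p hp
    rw [hp]
    rfl
  · refine .of_pairing (taylorKernel i) (contDiffOn_derivQuotCoeff i j k l) contDiffOn_id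
      (hswap _ l) fun γ => ?_
    filter_upwards [swapTorus_lift_ae (derivKernelSwap k) γ (derivCoord 2 l γ)] with p hp
    rw [hp]
    rfl
  · refine .of_pairing (taylorKernel i) (contDiffOn_taylorQuotCoeff i j k l) contDiffOn_id
      (hswap _ l) fun γ => ?_
    filter_upwards [swapTorus_lift_ae (taylorKernel k) γ (derivCoord 2 l γ)] with p hp
    rw [hp]
    rfl

/-! ### The kernel with unnormalized normals -/

/-- The rotation taking the tangent to the normal, as a linear map of the plane. -/
def rotate : Plane →ₗ[ℝ] Plane := Matrix.toEuclideanLin rot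

theorem rotate_apply (v : Plane) (j : Fin 2) : rotate v j = ∑ k, rot j k * v k := rfl

theorem rotate_eq (v : Plane) : rotate v = !₂[v 1, -v 0] := by
  ext j
  fin_cases j <;> simp [rotate_apply, rot]

theorem norm_rotate (v : Plane) : ‖rotate v‖ = ‖v‖ := by
  simp [rotate_eq, norm_plane_eq, add_comm]

theorem inner_rotate (v w : Plane) : inner ℝ (rotate v) w = v 1 * w 0 - v 0 * w 1 := by
  simp only [rotate_eq, PiLp.inner_apply, Fin.sum_univ_two, RCLike.inner_apply', conj_trivial,
    Matrix.cons_val_zero, Matrix.cons_val_one]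
  ring

theorem inner_rotate_sub_smul (v w : Plane) (c : ℝ) :
    inner ℝ (rotate v) (w - c • v) = inner ℝ (rotate v) w := by
  simp only [inner_rotate, PiLp.sub_apply, PiLp.smul_apply, smul_eq_mul]
  ring

/-- The kernel `K(γ)(x, y)` with `γ'` rotated in place of the unit normal at both points. -/
def rotatedKernel (γ : Sobolev 2) (x y : Circ) : ℝ :=
  inner ℝ (rotate (d1 γ x)) (chord γ x y) * inner ℝ (rotate (d1 γ y)) (chord γ x y) *
    ‖chord γ x y‖⁻¹ ^ 3

theorem chord_swap (γ : Sobolev 2) (x y : Circ) : chord γ y x = -chord γ x y :=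
  (neg_sub _ _).symm

theorem rotatedKernel_comm (γ : Sobolev 2) (x y : Circ) :
    rotatedKernel γ y x = rotatedKernel γ x y := by
  simp only [rotatedKernel, chord_swap γ x y, norm_neg, inner_neg_right]
  ring

/-- The `ℓ¹` norm of the second derivative `γ''(x)`. -/
def absAccel (γ : Sobolev 2) (x : Circ) : ℝ := |derivCoord 2 0 γ x| + |derivCoord 2 1 γ x|

theorem memLp_absAccel (γ : Sobolev 2) : MemLp (absAccel γ) 2 :=
  (Lp.memLp (derivCoord 2 0 γ)).norm.add (Lp.memLp (derivCoord 2 1 γ)).norm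

theorem integrable_absAccel (γ : Sobolev 2) : Integrable (absAccel γ) :=
  (memLp_absAccel γ).integrable one_le_two

theorem sq_integral_le {f : ℝ → ℝ} {a b : ℝ} (hab : a < b) (hf : IntervalIntegrable f volume a b)
    (hf2 : IntervalIntegrable (fun t => f t ^ 2) volume a b) :
    (∫ t in a..b, f t) ^ 2 ≤ (b - a) * ∫ t in a..b, f t ^ 2 := by
  have hL : 0 < b - a := sub_pos.mpr hab
  set m := (∫ t in a..b, f t) / (b - a) with hm
  have hI : ∫ t in a..b, f t = m * (b - a) := by rw [hm]; field_simp
  have hvariance : 0 ≤ ∫ t in a..b, (f t ^ 2 - 2 * m * f t + m ^ 2) :=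
    intervalIntegral.integral_nonneg hab.le fun t _ => by nlinarith [sq_nonneg (f t - m)]
  rw [intervalIntegral.integral_add (hf2.sub (hf.const_mul _)) (by simp),
    intervalIntegral.integral_sub hf2 (hf.const_mul _), intervalIntegral.integral_const_mul,
    intervalIntegral.integral_const, hI, smul_eq_mul] at hvariance
  rw [hI]
  nlinarith [mul_nonneg hL.le hvariance]

theorem norm_d1_le (γ : Sobolev 2) (x : Circ) : ‖d1 γ x‖ ≤ (d1Bound 0 + d1Bound 1) * ‖γ‖ :=
  (norm_plane_le _).trans <| by
    rw [add_mul]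
    exact add_le_add (abs_d1_le_mul_norm 0 γ x) (abs_d1_le_mul_norm 1 γ x)

theorem norm_chord_sub_smul_d1_le (γ : Sobolev 2) {a b c : ℝ} (hab : a ≤ b) (hc : c ∈ Icc a b) :
    ‖chord γ a b - (b - a) • d1 γ c‖ ≤ (b - a) * ∫ t in a..b, absAccel γ t := by
  have hint i := integrable_L2Real (derivCoord 2 i γ)
  have htaylor i := (isPrimitive_val γ i).abs_taylor_le (isPrimitive_d1 γ i) (hint i) hab hc
  simp only [absAccel]
  rw [intervalIntegral.integral_add (intervalIntegrable_coe (hint 0) a b).abs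
    (intervalIntegrable_coe (hint 1) a b).abs, mul_add]
  exact (norm_plane_le _).trans (add_le_add (htaylor 0) (htaylor 1))

theorem abs_inner_rotate_d1_chord_le (γ : Sobolev 2) {a b c : ℝ} (hab : a ≤ b)
    (hc : c ∈ Icc a b) :
    |inner ℝ (rotate (d1 γ c)) (chord γ a b)| ≤
      (d1Bound 0 + d1Bound 1) * ‖γ‖ * ((b - a) * ∫ t in a..b, absAccel γ t) := by
  rw [← inner_rotate_sub_smul _ _ (b - a)]
  refine (abs_real_inner_le_norm _ _).trans ?_
  rw [norm_rotate]
  exact mul_le_mul (norm_d1_le γ c) (norm_chord_sub_smul_d1_le γ hab hc) (norm_nonneg _)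
    ((norm_nonneg _).trans (norm_d1_le γ c))

theorem exists_abs_rotatedKernel_le {γ : Sobolev 2} (hγ : γ ∈ V) : ∃ C, 0 ≤ C ∧ ∀ a b : ℝ,
    a < b → b ≤ a + 1 / 2 →
      |rotatedKernel γ a b| ≤ C * ∫ t in a..b, absAccel γ (t : Circ) ^ 2 := by
  have hγ' : 0 < chordArc γ := hγ
  set M := (d1Bound 0 + d1Bound 1) * ‖γ‖
  refine ⟨M ^ 2 * (chordArc γ)⁻¹ ^ 3, by positivity, fun a b hab hb => ?_⟩
  have hL : 0 < b - a := sub_pos.mpr hab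
  have hchord : ‖chord γ (a : Circ) (b : Circ)‖⁻¹ ≤ (chordArc γ)⁻¹ * (b - a)⁻¹ := by
    have hdist := dist_coe_of_le hab.le hb
    have hne : (a : Circ) ≠ (b : Circ) := dist_pos.mp (hdist ▸ hL)
    rw [← mul_inv, ← hdist]
    rw [← hdist] at hL
    exact inv_anti₀ (by positivity) (chordArc_mul_dist_le γ hne)
  have hfst := abs_inner_rotate_d1_chord_le γ hab.le (left_mem_Icc.mpr hab.le)
  have hsnd := abs_inner_rotate_d1_chord_le γ hab.le (right_mem_Icc.mpr hab.le)
  have hsq := sq_integral_le hab (intervalIntegrable_coe (integrable_absAccel γ) a b)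
    (intervalIntegrable_coe (memLp_absAccel γ).integrable_sq a b)
  set I := ∫ t in a..b, absAccel γ (t : Circ)
  rw [rotatedKernel, abs_mul, abs_mul, abs_of_nonneg (by positivity : 0 ≤ ‖chord γ a b‖⁻¹ ^ 3)]
  calc _ ≤ (M * ((b - a) * I)) * (M * ((b - a) * I)) * ((chordArc γ)⁻¹ * (b - a)⁻¹) ^ 3 := by
        have := (abs_nonneg _).trans hfst
        gcongr
    _ = M ^ 2 * (chordArc γ)⁻¹ ^ 3 * (b - a)⁻¹ * I ^ 2 := by field_simp
    _ ≤ M ^ 2 * (chordArc γ)⁻¹ ^ 3 * (b - a)⁻¹ *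
        ((b - a) * ∫ t in a..b, absAccel γ (t : Circ) ^ 2) := by gcongr
    _ = _ := by field_simp

/-! ### The kernel of the forcing -/

/-- The second derivative `γ''`, assembled from the representatives of its coordinates. -/
def accel (γ : Sobolev 2) (x : Circ) : Plane := !₂[derivCoord 2 0 γ x, derivCoord 2 1 γ x]

theorem accel_apply (γ : Sobolev 2) (x : Circ) (i : Fin 2) : accel γ x i = derivCoord 2 i γ x := by
  fin_cases i <;> rfl

/-- The factor `|γ'(y)|⁻³ ⟨rot γ'(y), γ''(y)⟩` of the integrand of the forcing, which is
`-|γ'(y)|⁻¹ κ(γ)(y)`. -/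
def sourceDensity (γ : Sobolev 2) (y : Circ) : ℝ :=
  ‖d1 γ y‖⁻¹ ^ 3 * inner ℝ (rotate (d1 γ y)) (accel γ y)

/-- The `j`-th coordinate of the factor of the integrand of the forcing depending on `x`. -/
def forceKernel (j : Fin 2) (γ : Sobolev 2) (y x : Circ) : ℝ :=
  ‖d1 γ x‖⁻¹ ^ 2 * rotate (d1 γ x) j * rotatedKernel γ x y

/-- The derivative of `rotatedKernel` in `x`. -/
def rotatedKernelDeriv (γ : Sobolev 2) (x y : Circ) : ℝ :=
  (inner ℝ (rotate (accel γ x)) (chord γ x y) * inner ℝ (rotate (d1 γ y)) (chord γ x y) -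
      inner ℝ (rotate (d1 γ x)) (chord γ x y) * inner ℝ (rotate (d1 γ y)) (d1 γ x)) *
      ‖chord γ x y‖⁻¹ ^ 3 +
    3 * (inner ℝ (rotate (d1 γ x)) (chord γ x y) * inner ℝ (rotate (d1 γ y)) (chord γ x y)) *
      inner ℝ (d1 γ x) (chord γ x y) * ‖chord γ x y‖⁻¹ ^ 5

/-- The derivative of `forceKernel` in `x`. -/
def forceKernelDeriv (j : Fin 2) (γ : Sobolev 2) (y x : Circ) : ℝ :=
  (‖d1 γ x‖⁻¹ ^ 2 * rotate (accel γ x) j -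
      2 * ‖d1 γ x‖⁻¹ ^ 4 * inner ℝ (d1 γ x) (accel γ x) * rotate (d1 γ x) j) *
      rotatedKernel γ x y +
    ‖d1 γ x‖⁻¹ ^ 2 * rotate (d1 γ x) j * rotatedKernelDeriv γ x y

theorem inner_plane (v w : Plane) : inner ℝ v w = ∑ i, v i * w i := by
  simp only [PiLp.inner_apply, RCLike.inner_apply', conj_trivial]

section Apply

variable (i j k l m : Fin 2) {γ : Sobolev 2}

theorem normalFst_apply (p : OffDiag) : normalFst i γ p = rotate (d1 γ p.1.1) i := by
  simp [normalFst, rotate_apply, d1Fst_apply]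

theorem normalSnd_apply (p : OffDiag) : normalSnd i γ p = rotate (d1 γ p.1.2) i := by
  simp [normalSnd, rotate_apply, d1Snd_apply]

theorem normalSndDotChordQuot_apply (p : OffDiag) : normalSndDotChordQuot γ p =
    inner ℝ (rotate (d1 γ p.1.2)) (chord γ p.1.1 p.1.2) / dist p.1.1 p.1.2 := by
  simp only [normalSndDotChordQuot, Fin.sum_univ_two, BoundedContinuousFunction.coe_add,
    BoundedContinuousFunction.coe_mul, Pi.add_apply, Pi.mul_apply, normalSnd_apply,
    chordQuot_apply, inner_plane]
  ring

theorem d1FstDotChordQuot_apply (p : OffDiag) : d1FstDotChordQuot γ p =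
    inner ℝ (d1 γ p.1.1) (chord γ p.1.1 p.1.2) / dist p.1.1 p.1.2 := by
  simp only [d1FstDotChordQuot, Fin.sum_univ_two, BoundedContinuousFunction.coe_add,
    BoundedContinuousFunction.coe_mul, Pi.add_apply, Pi.mul_apply, d1Fst_apply, chordQuot_apply,
    inner_plane]
  ring

variable (hγ : γ ∈ V)
include hγ

theorem invSpeedFst_apply (p : OffDiag) : invSpeedFst γ p = ‖d1 γ p.1.1‖⁻¹ := by
  rw [invSpeedFst, invNorm_apply (pow_pos hγ 2) fun p => sq_chordArc_le_d1 hγ p.1.1,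
    norm_plane_eq]
  rfl

theorem invSpeedSnd_apply (p : OffDiag) : invSpeedSnd γ p = ‖d1 γ p.1.2‖⁻¹ := by
  rw [invSpeedSnd, invNorm_apply (pow_pos hγ 2) fun p => sq_chordArc_le_d1 hγ p.1.2,
    norm_plane_eq]
  rfl

theorem invChordQuot_apply (p : OffDiag) :
    invChordQuot γ p = dist p.1.1 p.1.2 * ‖chord γ p.1.1 p.1.2‖⁻¹ := by
  have hd : 0 < dist p.1.1 p.1.2 := dist_pos.mpr p.2
  rw [invChordQuot, invNorm_apply (pow_pos hγ 2) fun p => sq_chordArc_le_chordQuot hγ p,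
    norm_plane_eq, chordQuot_apply, chordQuot_apply, div_pow, div_pow, ← add_div,
    Real.sqrt_div (by positivity), Real.sqrt_sq hd.le, inv_div, div_eq_mul_inv]

theorem commonCoeff_apply (p : OffDiag) : commonCoeff l γ p =
    rotate (d1 γ p.1.2) l * ‖d1 γ p.1.2‖⁻¹ ^ 3 *
      (dist p.1.1 p.1.2 * ‖chord γ p.1.1 p.1.2‖⁻¹) ^ 3 := by
  simp [commonCoeff, normalSnd_apply, invSpeedSnd_apply hγ, invChordQuot_apply hγ]

variable {x y : Circ} (h : x ≠ y)
include h

theorem extend_forceCoeff : extend (forceCoeff j l i γ) (x, y) =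
    rotate (d1 γ y) l * ‖d1 γ y‖⁻¹ ^ 3 * (dist x y * ‖chord γ x y‖⁻¹) ^ 3 *
      ‖d1 γ x‖⁻¹ ^ 2 * rotate (d1 γ x) j * rotate (d1 γ x) i *
      (inner ℝ (rotate (d1 γ y)) (chord γ x y) / dist x y) := by
  rw [extend_of_ne _ h]
  simp [forceCoeff, commonCoeff_apply l hγ, invSpeedFst_apply hγ,
    normalFst_apply, normalSndDotChordQuot_apply]

theorem extend_accelCoeff : extend (accelCoeff j l m i γ) (x, y) =
    rotate (d1 γ y) l * ‖d1 γ y‖⁻¹ ^ 3 * (dist x y * ‖chord γ x y‖⁻¹) ^ 3 *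
      rotate (d1 γ x) i * (inner ℝ (rotate (d1 γ y)) (chord γ x y) / dist x y) *
      (rot j m * ‖d1 γ x‖⁻¹ ^ 2 - 2 * (‖d1 γ x‖⁻¹ ^ 4 * d1 γ x m * rotate (d1 γ x) j)) := by
  rw [extend_of_ne _ h]
  simp [accelCoeff, commonCoeff_apply l hγ, invSpeedFst_apply hγ,
    normalFst_apply, normalSndDotChordQuot_apply, d1Fst_apply]

theorem extend_accelSwapCoeff : extend (accelSwapCoeff j l m i γ) (x, y) =
    -(rotate (d1 γ y) l * ‖d1 γ y‖⁻¹ ^ 3 * (dist x y * ‖chord γ x y‖⁻¹) ^ 3 *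
      ‖d1 γ x‖⁻¹ ^ 2 * rotate (d1 γ x) j * ((∑ k, rot k m * chord γ x y k) / dist x y) *
      rotate (d1 γ y) i) := by
  rw [extend_of_ne _ h]
  simp only [accelSwapCoeff, Fin.sum_univ_two, BoundedContinuousFunction.coe_neg,
    BoundedContinuousFunction.coe_mul, BoundedContinuousFunction.coe_add,
    BoundedContinuousFunction.coe_smul, BoundedContinuousFunction.pow_apply, smul_eq_mul,
    Pi.neg_apply, Pi.mul_apply, Pi.add_apply, commonCoeff_apply l hγ, invSpeedFst_apply hγ,
    normalFst_apply, normalSnd_apply, chordQuot_apply]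
  ring

theorem extend_derivQuotCoeff : extend (derivQuotCoeff j l i k γ) (x, y) =
    -(rotate (d1 γ y) l * ‖d1 γ y‖⁻¹ ^ 3 * (dist x y * ‖chord γ x y‖⁻¹) ^ 3 *
      ‖d1 γ x‖⁻¹ ^ 2 * rotate (d1 γ x) j * rotate (d1 γ x) i * rotate (d1 γ y) k) := by
  rw [extend_of_ne _ h]
  simp [derivQuotCoeff, commonCoeff_apply l hγ, invSpeedFst_apply hγ,
    normalFst_apply, normalSnd_apply]

theorem extend_taylorQuotCoeff : extend (taylorQuotCoeff j l i k γ) (x, y) =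
    -(3 * (rotate (d1 γ y) l * ‖d1 γ y‖⁻¹ ^ 3 * (dist x y * ‖chord γ x y‖⁻¹) ^ 3 *
      ‖d1 γ x‖⁻¹ ^ 2 * rotate (d1 γ x) j * rotate (d1 γ x) i * rotate (d1 γ y) k *
      (inner ℝ (d1 γ x) (chord γ x y) / dist x y) * (dist x y * ‖chord γ x y‖⁻¹) ^ 2)) := by
  rw [extend_of_ne _ h]
  simp [taylorQuotCoeff, commonCoeff_apply l hγ, invSpeedFst_apply hγ,
    normalFst_apply, normalSnd_apply, d1FstDotChordQuot_apply, invChordQuot_apply hγ]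

end Apply

section Sums

variable (γ : Sobolev 2) (x y : Circ)

theorem sum_rotate_mul_taylorQuot : ∑ i, rotate (d1 γ x) i * taylorQuot i γ (x, y) =
    inner ℝ (rotate (d1 γ x)) (chord γ x y) / dist x y ^ 2 := by
  rw [← inner_rotate_sub_smul _ _ (signedDist x y), inner_plane, Finset.sum_div]
  exact Finset.sum_congr rfl fun i _ => (mul_div_assoc _ _ _).symm

theorem sum_rotate_mul_taylorQuot_swap : ∑ i, rotate (d1 γ y) i * taylorQuot i γ (y, x) =
    -(inner ℝ (rotate (d1 γ y)) (chord γ x y) / dist x y ^ 2) := by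
  rw [sum_rotate_mul_taylorQuot, chord_swap γ x y, dist_comm, inner_neg_right, neg_div]

theorem sum_rotate_mul_derivQuot : ∑ i, rotate (d1 γ y) i * derivQuot i γ (x, y) =
    inner ℝ (rotate (d1 γ y)) (d1 γ x) / dist x y := by
  rw [← inner_rotate_sub_smul _ _ 1, one_smul, inner_plane, Finset.sum_div]
  exact Finset.sum_congr rfl fun i _ => (mul_div_assoc _ _ _).symm

theorem inner_derivCoord (v : Plane) : inner ℝ v (accel γ x) = ∑ l, v l * derivCoord 2 l γ x := by
  simp_rw [inner_plane, accel_apply]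

theorem rotate_accel_apply (j : Fin 2) :
    rotate (accel γ x) j = ∑ m, rot j m * derivCoord 2 m γ x := by
  simp_rw [rotate_apply, accel_apply]

theorem inner_rotate_accel (v : Plane) :
    inner ℝ (rotate (accel γ x)) v = ∑ m, (∑ k, rot k m * v k) * derivCoord 2 m γ x := by
  simp_rw [inner_plane, rotate_accel_apply, Finset.sum_mul]
  rw [Finset.sum_comm]
  exact Finset.sum_congr rfl fun m _ => Finset.sum_congr rfl fun k _ => by ring

end Sums

section Densities

variable (j : Fin 2) {γ : Sobolev 2} (hγ : γ ∈ V) {x y : Circ} (h : x ≠ y)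
include hγ h

theorem forceDensity_eq : forceDensity j γ (x, y) =
    (1 / (2 * Real.pi)) * (sourceDensity γ y * forceKernel j γ y x) := by
  have hd : dist x y ≠ 0 := dist_ne_zero.mpr h
  rw [forceDensity, sourceDensity, forceKernel, rotatedKernel, inner_derivCoord]
  congr 1
  calc _ = ‖d1 γ y‖⁻¹ ^ 3 * (dist x y * ‖chord γ x y‖⁻¹) ^ 3 * ‖d1 γ x‖⁻¹ ^ 2 *
        rotate (d1 γ x) j * (inner ℝ (rotate (d1 γ y)) (chord γ x y) / dist x y) *
        (∑ l, rotate (d1 γ y) l * derivCoord 2 l γ y) *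
        ∑ i, rotate (d1 γ x) i * taylorQuot i γ (x, y) := by
          simp only [extend_forceCoeff _ _ _ hγ h, Fin.sum_univ_two]
          ring
    _ = _ := by
          rw [sum_rotate_mul_taylorQuot]
          field_simp

theorem sum_accelCoeff : ∑ l, ∑ m, ∑ i, extend (accelCoeff j l m i γ) (x, y) *
      (derivCoord 2 l γ y * (taylorQuot i γ (x, y) * derivCoord 2 m γ x)) =
    sourceDensity γ y * ((‖d1 γ x‖⁻¹ ^ 2 * rotate (accel γ x) j -
      2 * ‖d1 γ x‖⁻¹ ^ 4 * inner ℝ (d1 γ x) (accel γ x) * rotate (d1 γ x) j) *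
      rotatedKernel γ x y) := by
  have hd : dist x y ≠ 0 := dist_ne_zero.mpr h
  simp only [sourceDensity, rotatedKernel, inner_derivCoord, rotate_accel_apply]
  calc _ = ‖d1 γ y‖⁻¹ ^ 3 * (dist x y * ‖chord γ x y‖⁻¹) ^ 3 *
        (inner ℝ (rotate (d1 γ y)) (chord γ x y) / dist x y) *
        (∑ l, rotate (d1 γ y) l * derivCoord 2 l γ y) *
        (‖d1 γ x‖⁻¹ ^ 2 * ∑ m, rot j m * derivCoord 2 m γ x -
          2 * ‖d1 γ x‖⁻¹ ^ 4 * (∑ m, d1 γ x m * derivCoord 2 m γ x) * rotate (d1 γ x) j) *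
        ∑ i, rotate (d1 γ x) i * taylorQuot i γ (x, y) := by
          simp only [extend_accelCoeff _ _ _ _ hγ h, Fin.sum_univ_two]
          ring
    _ = _ := by
          rw [sum_rotate_mul_taylorQuot]
          field_simp

theorem sum_accelSwapCoeff : ∑ l, ∑ m, ∑ i, extend (accelSwapCoeff j l m i γ) (x, y) *
      (derivCoord 2 l γ y * (taylorQuot i γ (y, x) * derivCoord 2 m γ x)) =
    sourceDensity γ y * (‖d1 γ x‖⁻¹ ^ 2 * rotate (d1 γ x) j *
      (inner ℝ (rotate (accel γ x)) (chord γ x y) * inner ℝ (rotate (d1 γ y)) (chord γ x y) *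
        ‖chord γ x y‖⁻¹ ^ 3)) := by
  have hd : dist x y ≠ 0 := dist_ne_zero.mpr h
  simp only [sourceDensity, inner_derivCoord, inner_rotate_accel]
  calc _ = -(‖d1 γ y‖⁻¹ ^ 3 * (dist x y * ‖chord γ x y‖⁻¹) ^ 3 * ‖d1 γ x‖⁻¹ ^ 2 *
        rotate (d1 γ x) j * (∑ l, rotate (d1 γ y) l * derivCoord 2 l γ y) *
        ((∑ m, (∑ k, rot k m * chord γ x y k) * derivCoord 2 m γ x) / dist x y) *
        ∑ i, rotate (d1 γ y) i * taylorQuot i γ (y, x)) := by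
          simp only [extend_accelSwapCoeff _ _ _ _ hγ h, Fin.sum_univ_two]
          ring
    _ = _ := by
          rw [sum_rotate_mul_taylorQuot_swap]
          field_simp

theorem sum_derivQuotCoeff : ∑ l, ∑ i, ∑ k, extend (derivQuotCoeff j l i k γ) (x, y) *
      (taylorQuot i γ (x, y) * (derivQuot k γ (x, y) * derivCoord 2 l γ y)) =
    -(sourceDensity γ y * (‖d1 γ x‖⁻¹ ^ 2 * rotate (d1 γ x) j *
      (inner ℝ (rotate (d1 γ x)) (chord γ x y) * inner ℝ (rotate (d1 γ y)) (d1 γ x) *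
        ‖chord γ x y‖⁻¹ ^ 3))) := by
  have hd : dist x y ≠ 0 := dist_ne_zero.mpr h
  rw [sourceDensity, inner_derivCoord]
  calc _ = -(‖d1 γ y‖⁻¹ ^ 3 * (dist x y * ‖chord γ x y‖⁻¹) ^ 3 * ‖d1 γ x‖⁻¹ ^ 2 *
        rotate (d1 γ x) j * (∑ l, rotate (d1 γ y) l * derivCoord 2 l γ y) *
        (∑ i, rotate (d1 γ x) i * taylorQuot i γ (x, y)) *
        ∑ k, rotate (d1 γ y) k * derivQuot k γ (x, y)) := by
          simp only [extend_derivQuotCoeff _ _ _ _ hγ h, Fin.sum_univ_two]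
          ring
    _ = _ := by
          rw [sum_rotate_mul_taylorQuot, sum_rotate_mul_derivQuot]
          field_simp

theorem sum_taylorQuotCoeff : ∑ l, ∑ i, ∑ k, extend (taylorQuotCoeff j l i k γ) (x, y) *
      (taylorQuot i γ (x, y) * (taylorQuot k γ (y, x) * derivCoord 2 l γ y)) =
    sourceDensity γ y * (‖d1 γ x‖⁻¹ ^ 2 * rotate (d1 γ x) j *
      (3 * (inner ℝ (rotate (d1 γ x)) (chord γ x y) * inner ℝ (rotate (d1 γ y)) (chord γ x y)) *
        inner ℝ (d1 γ x) (chord γ x y) * ‖chord γ x y‖⁻¹ ^ 5)) := by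
  have hd : dist x y ≠ 0 := dist_ne_zero.mpr h
  rw [sourceDensity, inner_derivCoord]
  calc _ = -(3 * (‖d1 γ y‖⁻¹ ^ 3 * (dist x y * ‖chord γ x y‖⁻¹) ^ 3 * ‖d1 γ x‖⁻¹ ^ 2 *
        rotate (d1 γ x) j * (∑ l, rotate (d1 γ y) l * derivCoord 2 l γ y) *
        (∑ i, rotate (d1 γ x) i * taylorQuot i γ (x, y)) *
        (∑ k, rotate (d1 γ y) k * taylorQuot k γ (y, x)) *
        (inner ℝ (d1 γ x) (chord γ x y) / dist x y) * (dist x y * ‖chord γ x y‖⁻¹) ^ 2)) := by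
          simp only [extend_taylorQuotCoeff _ _ _ _ hγ h, Fin.sum_univ_two]
          ring
    _ = _ := by
          rw [sum_rotate_mul_taylorQuot, sum_rotate_mul_taylorQuot_swap]
          field_simp

theorem forceDerivDensity_eq : forceDerivDensity j γ (x, y) =
    (1 / (2 * Real.pi)) * (sourceDensity γ y * forceKernelDeriv j γ y x) := by
  simp only [forceDerivDensity, Finset.sum_add_distrib, Prod.swap_prod_mk]
  rw [sum_accelCoeff j hγ h, sum_accelSwapCoeff j hγ h, sum_derivQuotCoeff j hγ h,
    sum_taylorQuotCoeff j hγ h, forceKernelDeriv, rotatedKernelDeriv]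
  ring

end Densities

/-! ### Differentiating the kernel in its first variable -/

section PlaneCurves

variable {u v u' v' : ℝ → Plane} {a b : ℝ}
  (hu : ∀ i, HasACDeriv (fun s => u s i) (fun s => u' s i) a b)
include hu

theorem hasACDeriv_rotate (j : Fin 2) :
    HasACDeriv (fun s => rotate (u s) j) (fun s => rotate (u' s) j) a b := by
  fin_cases j
  · simpa [rotate_eq] using hu 1
  · simpa [rotate_eq] using (hu 0).neg

theorem hasACDeriv_inner (hv : ∀ i, HasACDeriv (fun s => v s i) (fun s => v' s i) a b) :
    HasACDeriv (fun s => inner ℝ (u s) (v s))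
      (fun s => inner ℝ (u' s) (v s) + inner ℝ (u s) (v' s)) a b := by
  simp only [inner_plane, Fin.sum_univ_two]
  exact (((hu 0).mul (hv 0)).add ((hu 1).mul (hv 1))).congr_deriv fun s _ => by ring

theorem hasACDeriv_inv_norm_pow (hne : ∀ s ∈ uIcc a b, u s ≠ 0) (n : ℕ) :
    HasACDeriv (fun s => ‖u s‖⁻¹ ^ n)
      (fun s => -n * inner ℝ (u s) (u' s) * ‖u s‖⁻¹ ^ (n + 2)) a b := by
  have hrpow : ∀ s (k : ℕ), inner ℝ (u s) (u s) ^ (-(k / 2) : ℝ) = ‖u s‖⁻¹ ^ k := fun s k => by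
    rw [real_inner_self_eq_norm_sq, ← Real.rpow_natCast, ← Real.rpow_natCast,
      ← Real.rpow_mul (norm_nonneg _), Real.inv_rpow (norm_nonneg _),
      ← Real.rpow_neg (norm_nonneg _)]
    congr 1
    push_cast
    ring
  have hderiv := (hasACDeriv_inner hu hu).rpow_const
    (fun s hs => real_inner_self_pos.mpr (hne s hs)) (-(n / 2))
  simp only [hrpow] at hderiv
  refine hderiv.congr_deriv fun s _ => ?_
  rw [← hrpow, real_inner_comm (u s) (u' s)]
  push_cast
  ring_nf

end PlaneCurves

theorem hasACDeriv_d1 (γ : Sobolev 2) (a b : ℝ) (i : Fin 2) :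
    HasACDeriv (fun s : ℝ => d1 γ (s : Circ) i) (fun s : ℝ => accel γ (s : Circ) i) a b := by
  simp only [accel_apply]
  exact (isPrimitive_d1 γ i).hasACDeriv (integrable_L2Real _) a b

theorem hasACDeriv_chord (γ : Sobolev 2) (y : Circ) (a b : ℝ) (i : Fin 2) :
    HasACDeriv (fun s : ℝ => chord γ (s : Circ) y i) (fun s : ℝ => (-d1 γ (s : Circ)) i) a b := by
  have hd1 : Integrable fun x => d1 γ x i :=
    (continuous_d1_apply γ i).integrable_of_hasCompactSupport (.of_compactSpace _)
  exact ((HasACDeriv.const _).sub ((isPrimitive_val γ i).hasACDeriv hd1 a b)).congr_deriv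
    fun s _ => zero_sub _

theorem d1_ne_zero {γ : Sobolev 2} (hγ : γ ∈ V) (x : Circ) : d1 γ x ≠ 0 := fun h => by
  have hle := sq_chordArc_le_d1 hγ x
  have hpos : 0 < chordArc γ ^ 2 := pow_pos hγ 2
  simp only [h, PiLp.zero_apply] at hle
  linarith

theorem chord_ne_zero {γ : Sobolev 2} (hγ : γ ∈ V) {x y : Circ} (h : x ≠ y) : chord γ x y ≠ 0 :=
  norm_pos_iff.mp ((mul_pos hγ (dist_pos.mpr h)).trans_le (chordArc_mul_dist_le γ h))

theorem hasACDeriv_rotatedKernel {γ : Sobolev 2} (hγ : γ ∈ V) (y : Circ) {a b : ℝ}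
    (h : ∀ s ∈ uIcc a b, (s : Circ) ≠ y) :
    HasACDeriv (fun s : ℝ => rotatedKernel γ (s : Circ) y)
      (fun s : ℝ => rotatedKernelDeriv γ (s : Circ) y) a b := by
  have hd1 := hasACDeriv_d1 γ a b
  have hchord := hasACDeriv_chord γ y a b
  have hfst := hasACDeriv_inner (hasACDeriv_rotate hd1) hchord
  have hsnd := hasACDeriv_inner (u := fun _ => rotate (d1 γ y)) (u' := 0)
    (fun _ => HasACDeriv.const _) hchord
  have hnorm := hasACDeriv_inv_norm_pow hchord (fun s hs => chord_ne_zero hγ (h s hs)) 3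
  refine ((hfst.mul hsnd).mul hnorm).congr_deriv fun s _ => ?_
  have horth : inner ℝ (rotate (d1 γ s)) (d1 γ s) = 0 := by rw [inner_rotate]; ring
  simp only [Pi.zero_apply, inner_zero_left, inner_neg_right, horth, rotatedKernelDeriv,
    real_inner_comm (d1 γ s) (chord γ s y)]
  push_cast
  ring

theorem hasACDeriv_forceKernel (j : Fin 2) {γ : Sobolev 2} (hγ : γ ∈ V) (y : Circ) {a b : ℝ}
    (h : ∀ s ∈ uIcc a b, (s : Circ) ≠ y) :
    HasACDeriv (fun s : ℝ => forceKernel j γ y (s : Circ))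
      (fun s : ℝ => forceKernelDeriv j γ y (s : Circ)) a b := by
  have hd1 := hasACDeriv_d1 γ a b
  have hspeed := hasACDeriv_inv_norm_pow hd1 (fun s _ => d1_ne_zero hγ _) 2
  refine ((hspeed.mul (hasACDeriv_rotate hd1 j)).mul
    (hasACDeriv_rotatedKernel hγ y h)).congr_deriv fun s _ => ?_
  simp only [forceKernelDeriv]
  push_cast
  ring

theorem abs_invSpeed_sq_mul_rotate_le (j : Fin 2) {γ : Sobolev 2} (hγ : γ ∈ V) (x : Circ) :
    |‖d1 γ x‖⁻¹ ^ 2 * rotate (d1 γ x) j| ≤ (chordArc γ)⁻¹ := by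
  have hspeed : chordArc γ ≤ ‖d1 γ x‖ := by
    rw [norm_plane_eq]
    exact Real.le_sqrt_of_sq_le (sq_chordArc_le_d1 hγ x)
  have hpos : 0 < ‖d1 γ x‖ := norm_pos_iff.mpr (d1_ne_zero hγ x)
  calc |‖d1 γ x‖⁻¹ ^ 2 * rotate (d1 γ x) j| = ‖d1 γ x‖⁻¹ ^ 2 * |rotate (d1 γ x) j| := by
        rw [abs_mul, abs_of_nonneg (by positivity)]
    _ ≤ ‖d1 γ x‖⁻¹ ^ 2 * ‖d1 γ x‖ := by
        gcongr
        rw [← norm_rotate]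
        exact PiLp.norm_apply_le (rotate (d1 γ x)) j
    _ = ‖d1 γ x‖⁻¹ := by field_simp
    _ ≤ (chordArc γ)⁻¹ := inv_anti₀ hγ hspeed

theorem abs_forceKernel_le (j : Fin 2) {γ : Sobolev 2} (hγ : γ ∈ V) (x y : Circ) :
    |forceKernel j γ y x| ≤ (chordArc γ)⁻¹ * |rotatedKernel γ x y| := by
  rw [forceKernel, abs_mul]
  exact mul_le_mul_of_nonneg_right (abs_invSpeed_sq_mul_rotate_le j hγ x) (abs_nonneg _)

theorem tendsto_rotatedKernel {γ : Sobolev 2} (hγ : γ ∈ V) (r : ℝ) :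
    Tendsto (fun s : ℝ => rotatedKernel γ (s : Circ) (r : Circ)) (𝓝[≠] r) (𝓝 0) := by
  obtain ⟨C, -, hC⟩ := exists_abs_rotatedKernel_le hγ
  have hlim : Tendsto (fun s : ℝ => C * ∫ t in r..s, absAccel γ (t : Circ) ^ 2) (𝓝 r) (𝓝 0) := by
    simpa using ((intervalIntegral.continuous_primitive
      (intervalIntegrable_coe (memLp_absAccel γ).integrable_sq) r).const_mul C).tendsto r
  rw [← nhdsLT_sup_nhdsGT, tendsto_sup]
  constructor
  · refine squeeze_zero_norm' ?_ ((neg_zero (G := ℝ) ▸ hlim.neg).mono_left nhdsWithin_le_nhds)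
    filter_upwards [Ioo_mem_nhdsLT (show r - 1 / 2 < r by linarith)] with s hs
    rw [intervalIntegral.integral_symm, mul_neg, neg_neg]
    exact hC s r hs.2 (by linarith [hs.1])
  · refine squeeze_zero_norm' ?_ (hlim.mono_left nhdsWithin_le_nhds)
    filter_upwards [Ioo_mem_nhdsGT (show r < r + 1 / 2 by linarith)] with s hs
    rw [rotatedKernel_comm]
    exact hC r s hs.1 hs.2.le

theorem tendsto_forceKernel (j : Fin 2) {γ : Sobolev 2} (hγ : γ ∈ V) (r : ℝ) :
    Tendsto (fun s : ℝ => forceKernel j γ (r : Circ) (s : Circ)) (𝓝[≠] r) (𝓝 0) := by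
  have hlim := (tendsto_rotatedKernel hγ r).abs.const_mul (chordArc γ)⁻¹
  rw [abs_zero, mul_zero] at hlim
  exact squeeze_zero_norm (fun s => abs_forceKernel_le j hγ s r) hlim

/-! ### Integration by parts in the force kernel -/

theorem integral_eq_sub_of_tendsto {h g : ℝ → ℝ} {m b L : ℝ} {l : Filter ℝ} [l.NeBot]
    (hl : l ≤ 𝓝[uIcc m b] b) (hg : IntervalIntegrable g volume m b)
    (hac : ∀ᶠ x in l, HasACDeriv h g m x) (hh : Tendsto h l (𝓝 L)) :
    ∫ t in m..b, g t = L - h m := by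
  have hprimitive : Tendsto (fun x => ∫ t in m..x, g t) l (𝓝 (∫ t in m..b, g t)) :=
    ((intervalIntegral.continuousOn_primitive_interval' hg left_mem_uIcc) b
      right_mem_uIcc).mono_left hl
  exact tendsto_nhds_unique hprimitive
    ((hh.sub_const _).congr' (hac.mono fun x hx => hx.integral_eq.symm))

theorem integral_eq_sub_of_tendsto_endpoints {h g : ℝ → ℝ} {a b A B : ℝ} (hab : a < b)
    (hg : IntervalIntegrable g volume a b)
    (hac : ∀ c ∈ Ioo a b, ∀ d ∈ Ioo a b, HasACDeriv h g c d)
    (ha : Tendsto h (𝓝[>] a) (𝓝 A)) (hb : Tendsto h (𝓝[<] b) (𝓝 B)) :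
    ∫ x in a..b, g x = B - A := by
  obtain ⟨m, ham, hmb⟩ := exists_between hab
  have hgl : IntervalIntegrable g volume a m :=
    hg.mono_set (uIcc_subset_uIcc_left (Icc_subset_uIcc ⟨ham.le, hmb.le⟩))
  have hgr : IntervalIntegrable g volume m b :=
    hg.mono_set (uIcc_subset_uIcc_right (Icc_subset_uIcc ⟨ham.le, hmb.le⟩))
  have hleft : ∫ x in m..a, g x = A - h m := by
    refine integral_eq_sub_of_tendsto (nhdsWithin_le_of_mem ?_) hgl.symm ?_ ha
    · rw [uIcc_of_ge ham.le]
      exact mem_of_superset (Ioo_mem_nhdsGT ham) Ioo_subset_Icc_self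
    · filter_upwards [Ioo_mem_nhdsGT hab] with x hx using hac m ⟨ham, hmb⟩ x hx
  have hright : ∫ x in m..b, g x = B - h m := by
    refine integral_eq_sub_of_tendsto (nhdsWithin_le_of_mem ?_) hgr ?_ hb
    · rw [uIcc_of_le hmb.le]
      exact mem_of_superset (Ioo_mem_nhdsLT hmb) Ioo_subset_Icc_self
    · filter_upwards [Ioo_mem_nhdsLT hab] with x hx using hac m ⟨ham, hmb⟩ x hx
  rw [← intervalIntegral.integral_add_adjacent_intervals hgl hgr, hright,
    intervalIntegral.integral_symm, hleft]
  ring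

theorem integral_test_forceKernel (j : Fin 2) {γ : Sobolev 2} (hγ : γ ∈ V) (y : Circ)
    {φ : Circ → ℝ} (hφ : IsTest φ)
    (hint : Integrable fun x =>
      circDeriv φ x * forceKernel j γ y x + φ x * forceKernelDeriv j γ y x) :
    ∫ x, (circDeriv φ x * forceKernel j γ y x + φ x * forceKernelDeriv j γ y x) = 0 := by
  induction y using QuotientAddGroup.induction_on with | H r => ?_
  have hne : ∀ s ∈ Ioo r (r + 1), (s : Circ) ≠ (r : Circ) := fun s hs hsr =>
    hs.1.ne' ((AddCircle.coe_eq_coe_iff_of_mem_Ico ⟨hs.1.le, hs.2⟩ ⟨le_rfl, by linarith⟩).mp hsr)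
  have hvanish : ∀ q : ℝ, (q : Circ) = (r : Circ) → Tendsto
      (fun s : ℝ => φ (s : Circ) * forceKernel j γ (r : Circ) (s : Circ)) (𝓝[≠] q) (𝓝 0) := by
    intro q hq
    have hφq := ((ContDiff.continuous hφ).tendsto q).mono_left (nhdsWithin_le_nhds (s := {q}ᶜ))
    simpa [hq] using hφq.mul (tendsto_forceKernel j hγ q)
  rw [← UnitAddCircle.intervalIntegral_preimage r, ← sub_zero (0 : ℝ)]
  exact integral_eq_sub_of_tendsto_endpoints (by linarith) (intervalIntegrable_coe hint _ _)
    (fun c hc d hd => (hasACDeriv_of_isTest hφ c d).mul (hasACDeriv_forceKernel j hγ _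
      fun s hs => hne s (ordConnected_Ioo.uIcc_subset hc hd hs)))
    ((hvanish r rfl).mono_left (nhdsWithin_mono _ fun s hs => ne_of_gt hs))
    ((hvanish (r + 1) (AddCircle.coe_add_period 1 r)).mono_left
      (nhdsWithin_mono _ fun s hs => ne_of_lt hs))

theorem ae_ne (y : Circ) : ∀ᵐ x : Circ, x ≠ y := by
  have hzero : volume ({y} : Set Circ) = 0 := by
    rw [← Metric.closedBall_zero, AddCircle.volume_closedBall]
    simp
  simpa [ae_iff] using hzero

theorem isWeakDerivReal_forceLp (j : Fin 2) {γ : Sobolev 2} (hγ : γ ∈ V) :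
    IsWeakDerivReal (forceLp j γ) (forceDerivLp j γ) := by
  intro φ hφ
  have hforce := isSmoothDensity_forceLp j
  have hderiv := isSmoothDensity_forceDerivLp j
  have hint : Integrable (fun p : Circ × Circ =>
      circDeriv φ p.1 * forceDensity j γ p + φ p.1 * forceDerivDensity j γ p)
      (volume.prod volume) :=
    (hforce.integrable γ hγ _ hφ.continuous_circDeriv).add
      (hderiv.integrable γ hγ _ hφ.continuous)
  rw [hforce.integral_eq γ hγ _ hφ.continuous_circDeriv, hderiv.integral_eq γ hγ _ hφ.continuous,
    eq_neg_iff_add_eq_zero, ← integral_add (hforce.integrable γ hγ _ hφ.continuous_circDeriv)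
      (hderiv.integrable γ hγ _ hφ.continuous), Measure.volume_eq_prod, integral_prod_symm _ hint]
  refine integral_eq_zero_of_ae ?_
  filter_upwards [hint.prod_left_ae] with y hy
  have hae : (fun x => circDeriv φ x * forceDensity j γ (x, y) +
      φ x * forceDerivDensity j γ (x, y)) =ᵐ[volume] fun x => (1 / (2 * Real.pi) *
        sourceDensity γ y) *
        (circDeriv φ x * forceKernel j γ y x + φ x * forceKernelDeriv j γ y x) := by
    filter_upwards [ae_ne y] with x hx
    rw [forceDensity_eq j hγ hx, forceDerivDensity_eq j hγ hx]
    ring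
  rw [Pi.zero_apply, integral_congr_ae hae, integral_const_mul]
  -- the bracket need not be integrable where the source vanishes
  rcases eq_or_ne (1 / (2 * Real.pi) * sourceDensity γ y) 0 with h0 | h0
  · rw [h0, zero_mul]
  · have hbracket := hy.congr hae
    rw [integrable_const_mul_iff (isUnit_iff_ne_zero.mpr h0)] at hbracket
    rw [integral_test_forceKernel j hγ y hφ hbracket, mul_zero]

/-! ### The forcing -/

theorem normal_eq (γ : Sobolev 2) (x : Circ) : normal γ x = ‖d1 γ x‖⁻¹ • rotate (d1 γ x) := by
  ext i
  fin_cases i <;> simp [normal, tangent, rotate_eq]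

theorem accel_ae (γ : Sobolev 2) : accel γ =ᵐ[volume] d2 γ := by
  filter_upwards [derivCoord_ae 2 0 γ, derivCoord_ae 2 1 γ] with y h0 h1
  ext i
  fin_cases i
  exacts [h0, h1]

theorem kernel_mul_curvature_ae (γ : Sobolev 2) (x : Circ) :
    (fun y => kernel γ x y * curvature γ y) =ᵐ[volume]
      fun y => -‖d1 γ x‖⁻¹ * (rotatedKernel γ x y * sourceDensity γ y) := by
  filter_upwards [accel_ae γ] with y hy
  simp only [kernel, curvature, normal_eq, real_inner_smul_left, rotatedKernel, sourceDensity, hy]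
  ring

theorem exists_forall_abs_rotatedKernel_le {γ : Sobolev 2} (hγ : γ ∈ V) :
    ∃ C, ∀ x y, |rotatedKernel γ x y| ≤ C := by
  obtain ⟨C, hC0, hC⟩ := exists_abs_rotatedKernel_le hγ
  have hsq : Integrable fun x => absAccel γ x ^ 2 := (memLp_absAccel γ).integrable_sq
  have hlift : ∀ a b : ℝ, a < b → b - a ≤ 1 / 2 →
      |rotatedKernel γ (a : Circ) (b : Circ)| ≤ C * ∫ x, absAccel γ x ^ 2 := fun a b hab hb => by
    refine (hC a b hab (by linarith)).trans (mul_le_mul_of_nonneg_left ?_ hC0)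
    rw [← UnitAddCircle.intervalIntegral_preimage a]
    exact intervalIntegral.integral_mono_interval le_rfl hab.le (by linarith)
      (Eventually.of_forall fun t => sq_nonneg _) (intervalIntegrable_coe hsq _ _)
  refine ⟨C * ∫ x, absAccel γ x ^ 2, fun x y => ?_⟩
  obtain ⟨a, b, rfl, rfl, hab⟩ := exists_coe_abs_sub_le x y
  rcases lt_trichotomy a b with h | rfl | h
  · exact hlift a b h ((le_abs_self _).trans hab)
  · have hdiag : rotatedKernel γ (a : Circ) (a : Circ) = 0 := by simp [rotatedKernel, chord]
    rw [hdiag, abs_zero]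
    exact mul_nonneg hC0 (integral_nonneg fun x => sq_nonneg _)
  · rw [rotatedKernel_comm]
    exact hlift b a h (by linarith [neg_abs_le (b - a)])

theorem continuous_chord (γ : Sobolev 2) : Continuous fun p : Circ × Circ => chord γ p.1 p.2 :=
  ((continuous_val γ).comp continuous_snd).sub ((continuous_val γ).comp continuous_fst)

theorem continuous_rotate_d1 (γ : Sobolev 2) : Continuous fun x => rotate (d1 γ x) :=
  rotate.continuous_of_finiteDimensional.comp (continuous_d1 γ)

theorem measurable_rotatedKernel (γ : Sobolev 2) (x : Circ) :
    Measurable fun y => rotatedKernel γ x y := by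
  have hchord : Continuous fun y => chord γ x y :=
    (continuous_chord γ).comp (Continuous.prodMk_right x)
  exact ((continuous_const.inner hchord).measurable.mul
    ((continuous_rotate_d1 γ).inner hchord).measurable).mul
      (hchord.norm.measurable.inv.pow_const 3)

theorem continuousAt_rotatedKernel {γ : Sobolev 2} (hγ : γ ∈ V) {x y : Circ} (h : x ≠ y) :
    ContinuousAt (fun x => rotatedKernel γ x y) x := by
  have hchord : Continuous fun x => chord γ x y :=
    (continuous_chord γ).comp (Continuous.prodMk_left y)
  exact (((continuous_rotate_d1 γ).inner hchord).mul
    (continuous_const.inner hchord)).continuousAt.mul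
      ((hchord.norm.continuousAt.inv₀ (norm_ne_zero_iff.mpr (chord_ne_zero hγ h))).pow 3)

theorem continuous_inv_norm_d1 {γ : Sobolev 2} (hγ : γ ∈ V) : Continuous fun x => ‖d1 γ x‖⁻¹ :=
  (continuous_d1 γ).norm.inv₀ fun x => norm_ne_zero_iff.mpr (d1_ne_zero hγ x)

theorem integrable_sourceDensity {γ : Sobolev 2} (hγ : γ ∈ V) : Integrable (sourceDensity γ) := by
  have hcoord : ∀ i, Integrable fun y =>
      ‖d1 γ y‖⁻¹ ^ 3 * rotate (d1 γ y) i * derivCoord 2 i γ y := fun i =>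
    continuous_mul_integrable (((continuous_inv_norm_d1 hγ).pow 3).mul
      ((EuclideanSpace.proj i : Plane →L[ℝ] ℝ).continuous.comp (continuous_rotate_d1 γ)))
      (integrable_L2Real _)
  refine (integrable_finsetSum Finset.univ fun i _ => hcoord i).congr
    (Eventually.of_forall fun y => ?_)
  simp only [sourceDensity, inner_derivCoord, Finset.mul_sum, mul_assoc]

theorem integrable_rotatedKernel_mul_sourceDensity {γ : Sobolev 2} (hγ : γ ∈ V) (x : Circ) :
    Integrable fun y => rotatedKernel γ x y * sourceDensity γ y := by
  obtain ⟨C, hC⟩ := exists_forall_abs_rotatedKernel_le hγ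
  exact (integrable_sourceDensity hγ).bdd_mul (measurable_rotatedKernel γ x).aestronglyMeasurable
    (Eventually.of_forall fun y => hC x y)

theorem integrable_kernel_mul_curvature {γ : Sobolev 2} (hγ : γ ∈ V) (x : Circ) :
    Integrable fun y => kernel γ x y * curvature γ y :=
  ((integrable_rotatedKernel_mul_sourceDensity hγ x).const_mul _).congr
    (kernel_mul_curvature_ae γ x).symm

theorem forcing_eq (γ : Sobolev 2) (x : Circ) :
    forcing γ x = ((1 / (2 * Real.pi)) * (‖d1 γ x‖⁻¹ ^ 2 *
      ∫ y, rotatedKernel γ x y * sourceDensity γ y)) • rotate (d1 γ x) := by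
  rw [forcing, nonlocalF, integral_congr_ae (kernel_mul_curvature_ae γ x), integral_const_mul,
    normal_eq, smul_smul]
  congr 1
  ring

theorem continuous_integral_rotatedKernel {γ : Sobolev 2} (hγ : γ ∈ V) :
    Continuous fun x => ∫ y, rotatedKernel γ x y * sourceDensity γ y := by
  obtain ⟨C, hC⟩ := exists_forall_abs_rotatedKernel_le hγ
  refine continuous_iff_continuousAt.mpr fun x₀ =>
    continuousAt_of_dominated (bound := fun y => C * |sourceDensity γ y|)
      (Eventually.of_forall fun x =>
        (integrable_rotatedKernel_mul_sourceDensity hγ x).aestronglyMeasurable)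
      (Eventually.of_forall fun x => Eventually.of_forall fun y => ?_)
      ((integrable_sourceDensity hγ).abs.const_mul C) ?_
  · rw [norm_mul]
    exact mul_le_mul_of_nonneg_right (hC x y) (abs_nonneg _)
  · filter_upwards [ae_ne x₀] with y hy
    exact (continuousAt_rotatedKernel hγ hy.symm).mul continuousAt_const

theorem continuous_forcing {γ : Sobolev 2} (hγ : γ ∈ V) : Continuous (forcing γ) := by
  rw [funext (forcing_eq γ)]
  exact (continuous_const.mul (((continuous_inv_norm_d1 hγ).pow 2).mul
    (continuous_integral_rotatedKernel hγ))).smul (continuous_rotate_d1 γ)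

theorem ae_eq_of_forall_integral_mul_eq {u v : Circ → ℝ} (hu : MemLp u 2) (hv : MemLp v 2)
    (h : ∀ φ : Circ → ℝ, Continuous φ → ∫ x, φ x * u x = ∫ x, φ x * v x) : u =ᵐ[volume] v := by
  have hzero : ∀ φ : Circ → ℝ, Continuous φ → ∫ x, φ x * (u - v) x = 0 := fun φ hφ => by
    simp only [Pi.sub_apply, mul_sub]
    rw [integral_sub (continuous_mul_integrable hφ (hu.integrable one_le_two))
      (continuous_mul_integrable hφ (hv.integrable one_le_two)), h φ hφ, sub_self]
  obtain ⟨c, hc⟩ := ae_eq_const_of_forall_test (hu.sub hv)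
    fun φ hφ => hzero _ hφ.continuous_circDeriv
  have hmean := hzero (fun _ => 1) continuous_const
  simp only [one_mul, integral_congr_ae hc, integral_const, probReal_univ, one_smul] at hmean
  rw [hmean] at hc
  exact sub_ae_eq_zero u v |>.mp hc

theorem integral_forceDensity (j : Fin 2) {γ : Sobolev 2} (hγ : γ ∈ V) (x : Circ) :
    ∫ y, forceDensity j γ (x, y) = forcing γ x j := by
  have hae : (fun y => forceDensity j γ (x, y)) =ᵐ[volume] fun y => 1 / (2 * Real.pi) *
      (‖d1 γ x‖⁻¹ ^ 2 * rotate (d1 γ x) j * (rotatedKernel γ x y * sourceDensity γ y)) := by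
    filter_upwards [ae_ne x] with y hy
    rw [forceDensity_eq j hγ hy.symm, forceKernel]
    ring
  rw [integral_congr_ae hae, integral_const_mul, integral_const_mul, forcing_eq,
    PiLp.smul_apply, smul_eq_mul]
  ring

theorem forceLp_ae (j : Fin 2) {γ : Sobolev 2} (hγ : γ ∈ V) :
    forceLp j γ =ᵐ[volume] fun x => forcing γ x j := by
  have hcont : Continuous fun x => forcing γ x j :=
    (EuclideanSpace.proj j : Plane →L[ℝ] ℝ).continuous.comp (continuous_forcing hγ)
  refine ae_eq_of_forall_integral_mul_eq (Lp.memLp _)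
    (hcont.memLp_of_hasCompactSupport (.of_compactSpace _)) fun φ hφ => ?_
  have hint := (isSmoothDensity_forceLp j).integrable γ hγ φ hφ
  rw [(isSmoothDensity_forceLp j).integral_eq γ hγ φ hφ]
  rw [Measure.volume_eq_prod] at hint ⊢
  rw [integral_prod _ hint]
  simp only [integral_const_mul, integral_forceDensity j hγ]

/-! ### The forcing as an element of `H¹` -/

/-- The plane-valued `L²` function with given coordinates. -/
def ofCoords : (Fin 2 → L2Real) →L[ℝ] L2 :=
  ∑ j, ((ContinuousLinearMap.toSpanSingleton ℝ
    (EuclideanSpace.single j (1 : ℝ) : Plane)).compLpL 2 volume).comp (.proj j)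

theorem coord_ofCoords (i : Fin 2) (u : Fin 2 → L2Real) : coord i (ofCoords u) = u i := by
  refine Lp.ext ?_
  let axis j : ℝ →L[ℝ] Plane := .toSpanSingleton ℝ (EuclideanSpace.single j 1)
  have hsum : ofCoords u = (axis 0).compLpL 2 volume (u 0) + (axis 1).compLpL 2 volume (u 1) := by
    simp [ofCoords, axis]
  rw [hsum]
  filter_upwards [coord_ae i ((axis 0).compLpL 2 volume (u 0) + (axis 1).compLpL 2 volume (u 1)),
    Lp.coeFn_add ((axis 0).compLpL 2 volume (u 0)) ((axis 1).compLpL 2 volume (u 1)),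
    (axis 0).coeFn_compLpL (p := 2) (u 0), (axis 1).coeFn_compLpL (p := 2) (u 1)]
    with x hcoord hadd h0 h1
  rw [hcoord, hadd, Pi.add_apply, h0, h1]
  fin_cases i <;> simp [axis]

theorem continuous_integral_smul {ψ : Circ → ℝ} (hψ : Continuous ψ) :
    Continuous fun u : L2 => ∫ x, ψ x • u x := by
  have hmem : MemLp ψ 2 := hψ.memLp_of_hasCompactSupport (.of_compactSpace _)
  have hpairing : (fun u : L2 => ∫ x, ψ x • u x) =
      (ContinuousLinearMap.lsmul ℝ ℝ : ℝ →L[ℝ] Plane →L[ℝ] Plane).lpPairing volume 2 2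
        (hmem.toLp ψ) := funext fun u => by
    rw [ContinuousLinearMap.lpPairing_eq_integral]
    refine integral_congr_ae ?_
    filter_upwards [hmem.coeFn_toLp] with x hx
    rw [hx, ContinuousLinearMap.lsmul_apply]
  exact hpairing ▸ ContinuousLinearMap.continuous _

theorem isClosed_sobolev (k : ℕ) :
    IsClosed (Sobolev k : Set (PiLp 2 fun _ : Fin (k + 1) => L2)) := by
  have hset : (Sobolev k : Set (PiLp 2 fun _ : Fin (k + 1) => L2)) =
      ⋂ (j : Fin k) (φ : {φ : Circ → ℝ // IsTest φ}),
        {u | (∫ x, circDeriv φ.1 x • u j.castSucc x) = -(∫ x, φ.1 x • u j.succ x)} := by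
    ext u
    simp only [mem_iInter, Subtype.forall]
    rfl
  rw [hset]
  refine isClosed_iInter fun j => isClosed_iInter fun φ => isClosed_eq ?_ ?_
  · exact (continuous_integral_smul φ.2.continuous_circDeriv).comp (PiLp.continuous_apply 2 _ _)
  · exact ((continuous_integral_smul φ.2.continuous).comp (PiLp.continuous_apply 2 _ _)).neg

instance completeSpace_sobolev (k : ℕ) : CompleteSpace (Sobolev k) :=
  (isClosed_sobolev k).completeSpace_coe

/-- The forcing and its weak derivative, as an element of the space containing `H¹`. -/
def forcePair (γ : Sobolev 2) : PiLp 2 fun _ : Fin (1 + 1) => L2 :=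
  WithLp.toLp 2 ![ofCoords fun j => forceLp j γ, ofCoords fun j => forceDerivLp j γ]

theorem contDiffOn_forcePair : ContDiffOn ℝ ∞ forcePair V := by
  rw [contDiffOn_piLp]
  intro i
  fin_cases i
  · exact ofCoords.contDiff.comp_contDiffOn
      (contDiffOn_pi.mpr fun j => (isSmoothDensity_forceLp j).contDiffOn)
  · exact ofCoords.contDiff.comp_contDiffOn
      (contDiffOn_pi.mpr fun j => (isSmoothDensity_forceDerivLp j).contDiffOn)

theorem forcePair_mem {γ : Sobolev 2} (hγ : γ ∈ V) : forcePair γ ∈ Sobolev 1 := by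
  intro i
  obtain rfl : i = 0 := Subsingleton.elim _ _
  refine isWeakDeriv_iff.mpr fun j => ?_
  change IsWeakDerivReal (coord j (ofCoords _)) (coord j (ofCoords _))
  rw [coord_ofCoords, coord_ofCoords]
  exact isWeakDerivReal_forceLp j hγ

theorem forcing_ae {γ : Sobolev 2} (hγ : γ ∈ V) : forcing γ =ᵐ[volume] forcePair γ 0 := by
  have hcoord : ∀ i, (fun x => forcing γ x i) =ᵐ[volume] fun x => forcePair γ 0 x i := fun i =>
    (forceLp_ae i hγ).symm.trans
      ((coord_ofCoords i fun j => forceLp j γ) ▸ coord_ae i (forcePair γ 0))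
  filter_upwards [hcoord 0, hcoord 1] with x h0 h1
  ext i
  fin_cases i
  exacts [h0, h1]

/-- The forcing as a map into `H¹`. The orthogonal projection fixes `forcePair γ` for `γ ∈ V`; it
only serves to land in `H¹` for every `γ`. -/
def sobolevForcing (γ : Sobolev 2) : Sobolev 1 :=
  (Sobolev 1).orthogonalProjectionOnto (forcePair γ)

theorem contDiffOn_sobolevForcing : ContDiffOn ℝ ∞ sobolevForcing V :=
  (Sobolev 1).orthogonalProjectionOnto.contDiff.comp_contDiffOn contDiffOn_forcePair

theorem val_sobolevForcing {γ : Sobolev 2} (hγ : γ ∈ V) :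
    val (sobolevForcing γ) = forcing γ := by
  have hproj : sobolevForcing γ = ⟨forcePair γ, forcePair_mem hγ⟩ :=
    (Sobolev 1).orthogonalProjectionOnto_mem_subspace_eq_self ⟨_, forcePair_mem hγ⟩
  rw [val, hproj]
  exact contRep_eq (continuous_forcing hγ) (forcing_ae hγ)

end Langmuir

end

/-- `V` is open in `H²`, the integral that defines `F(γ)` converges at every point for `γ ∈ V`, and
`γ ↦ f(γ) = F(γ) ν(γ)` is a well-defined map of class `C^∞` from `V` into `H¹`. -/
theorem proposition4p12 :
    IsOpen Langmuir.V ∧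
    (∀ γ ∈ Langmuir.V, ∀ x : Langmuir.Circ,
      Integrable (fun y => Langmuir.kernel γ x y * Langmuir.curvature γ y)) ∧
    ∃ f : Langmuir.Sobolev 2 → Langmuir.Sobolev 1,
      (∀ γ ∈ Langmuir.V, ∀ x : Langmuir.Circ,
        Langmuir.val (f γ) x = Langmuir.forcing γ x) ∧
      ContDiffOn ℝ ∞ f Langmuir.V :=
  ⟨Langmuir.isOpen_V, fun _ hγ x => Langmuir.integrable_kernel_mul_curvature hγ x,
    Langmuir.sobolevForcing, fun _ hγ x => congrFun (Langmuir.val_sobolevForcing hγ) x,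
    Langmuir.contDiffOn_sobolevForcing⟩
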